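/- Let $n\ge 2p$ and let $X_1,\dots,X_n$ be i.i.d. from $\mathcal N_p(0,\Omega^{-1})$, $\Omega$ positive definite, with data matrix $\mathbf X\in\mathbb R^{n\times p}$. Let $G=(V,E)$ be the undirected graph on $V=[p]$ in which $i\ne j$ are adjacent if and only if coordinates $i$ and $j$ of a $\mathcal N_p(0,\Omega^{-1})$ vector are conditionally dependent given all other coordinates. Edge sets consist of undirected edges, so $(i,j)$ and $(j,i)$ count once. **Step 1 (node-wise statistics).** Fix one of two strategies: equi-correlated or SDP. For each $i\in[p]$ let $y=\mathbf X^{(i)}$ be column $i$ of $\mathbf X$, and let $D=\mathbf X^{(-i)}$ be the matrix of the remaining columns, either as it is or with columns scaled to unit length (the same option for all $i$). Almost surely $D^TD$ is invertible, and the knockoff matrix is $$\widetilde D=D\bigl(I-(D^TD)^{-1}\operatorname{diag}\{s\}\bigr)+\widetilde U C ,$$ where $\widetilde U$ has orthonormal columns orthogonal to those of $D$, $C^TC=2\operatorname{diag}\{s\}-\operatorname{diag}\{s\}(D^TD)^{-1}\operatorname{diag}\{s\}$, and $s$ is given by $s_j=\min(2\lambda_{\min}(D^TD),1)$ for all $j$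 (equi-correlated), or minimizes $\sum_j(1-s_j)$ subject to $\operatorname{diag}\{s\}\preceq 2D^TD$, $0\le s_j\le 1$ (SDP); $\widetilde D$ is a measurable function of $D$. The statistics are $(W^{(i)}_j)_{j\ne i}=\mathcal P_i(D,\widetilde D,y)$ and $W^{(i)}_i=0$. Here $\mathcal P_i$ is any procedure which, whenever $D^TD$ is invertible and the Gram matrix of $[D\ \widetilde D]$ is $$\begin{pmatrix}D^TD&D^TD-\operatorname{diag}\{s\}\\D^TD-\operatorname{diag}\{s\}&D^TD\end{pmatrix}\quad\text{for some } s\ge 0,$$ is a measurable function of $[D\ \widetilde D]^T[D\ \widetilde D]$ and $[D\ \widetilde D]^Ty$ (sufficiency), and such that, for every index set $H$, swapping the columns of $D$ and $\widetilde D$ indexed by $H$ changes the signs of exactly the statistics indexed by $H$ (antisymmetry). **Step 2 (global thresholds).** Let $q\in[0,1]$ and $(a,c_a)\in\{(1,1.93),(0.01,102)\}$. For $T\in(0,+\infty]^p$ let $\widehat V_i^{\pm}(T_i)=\{j\in[p]:\pm W_j^{(i)}\ge T_i\}$. Let $\widehat E(T)$ consist of the pairs $\{i,j\}$ with $i\in\widehat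 V_j^+(T_j)$ and $j\in\widehat V_i^+(T_i)$ (AND rule), or with at least one of the two (OR rule). Put $r=2q/(c_ap)$ for AND and $r=q/(c_ap)$ for OR. Call $T$ feasible if for all $i\in[p]$ $$T_i\in\bigl(\{|W^{(i)}_j|:j\in[p]\}\cup\{+\infty\}\bigr)\setminus\{0\}\quad\text{and}\quad\frac{a+|\widehat V_i^-(T_i)|}{|\widehat E(T)|\vee 1}\le r .$$ The global program maximizes $|\widehat E(T)|$ over feasible $T$; its solution is set to $(+\infty,\dots,+\infty)$ if no $T$ is feasible. The threshold algorithm computes $\widehat T$ as follows. Let $m_{\max}$ be $\lfloor q(p-1)/c_a-a\rfloor$ for AND and $\lfloor q(p-1)/(2c_a)-a\rfloor$ for OR. For $m=m_{\max},m_{\max}-1,\dots,0$ consider the vector $T$ whose entry $T_i$ is the smallest element $t$ of $(\{|W^{(i)}_j|:j\in[p]\}\cup\{+\infty\})\setminus\{0\}$ with $|\widehat V_i^-(t)|\le m$. Return the first such vector that is feasible, and $(+\infty,\dots,+\infty)$ if there is none (in particular if $m_{\max}<0$). **Conclusion.** For every choice of the above, for both rules, and with $\widehat T$ either the output of the threshold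 algorithm or any (measurable) solution of the global program, the estimated edge set $\widehat E=\widehat E(\widehat T)$ satisfies $$\mathbb E\left[\frac{|\widehat E\setminus E|}{|\widehat E|\vee 1}\right]\le q .$$ -/

import Mathlib

open MeasureTheory ProbabilityTheory Matrix

noncomputable section

namespace GGMKnockoff

/-! ### The conditional-independence graph of a random vector -/

/-- The σ-algebra on `ℝᵖ` generated by the coordinates other than `i` and `j`. -/
abbrev otherCoordinates {p : ℕ} (i j : Fin p) : MeasurableSpace (EuclideanSpace ℝ (Fin p)) :=
  ⨆ k : {k : Fin p // k ≠ i ∧ k ≠ j},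
    MeasurableSpace.comap (fun x : EuclideanSpace ℝ (Fin p) => x k) inferInstance

theorem otherCoordinates_le {p : ℕ} (i j : Fin p) :
    otherCoordinates i j ≤ (inferInstance : MeasurableSpace (EuclideanSpace ℝ (Fin p))) :=
  iSup_le fun k => Measurable.comap_le (by fun_prop)

theorem otherCoordinates_comm {p : ℕ} (i j : Fin p) :
    otherCoordinates i j = otherCoordinates j i := by
  unfold otherCoordinates
  simp only [iSup_subtype]
  simp only [and_comm]

/-- Under the law `μ`, the coordinates `i` and `j` are conditionally independent given all the
remaining coordinates. -/
def CondIndepGivenRest {p : ℕ} (μ : Measure (EuclideanSpace ℝ (Fin p))) [IsFiniteMeasure μ]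
    (i j : Fin p) : Prop :=
  CondIndepFun (otherCoordinates i j) (otherCoordinates_le i j)
    (fun x : EuclideanSpace ℝ (Fin p) => x i) (fun x : EuclideanSpace ℝ (Fin p) => x j) μ

theorem CondIndepGivenRest.symm {p : ℕ} {μ : Measure (EuclideanSpace ℝ (Fin p))}
    [IsFiniteMeasure μ] {i j : Fin p} (h : CondIndepGivenRest μ i j) :
    CondIndepGivenRest μ j i := by
  unfold CondIndepGivenRest at h ⊢
  simp only [otherCoordinates_comm j i]
  exact CondIndepFun.symm h

/-- The undirected graph with an edge between `i ≠ j` exactly when the coordinates `i` and `j` are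
conditionally dependent given the remaining ones. -/
def condIndepGraph {p : ℕ} (μ : Measure (EuclideanSpace ℝ (Fin p))) [IsFiniteMeasure μ] :
    SimpleGraph (Fin p) where
  Adj i j := i ≠ j ∧ ¬ CondIndepGivenRest μ i j
  symm := ⟨fun _ _ h => ⟨h.1.symm, fun h' => h.2 h'.symm⟩⟩
  loopless := ⟨fun _ h => h.1 rfl⟩

/-! ### Fixed-X knockoffs and feature statistics for a linear model -/

section LinearModel

variable {n ι : Type*} [Fintype n] [Fintype ι] [DecidableEq ι]

/-- The two scalings of a design matrix: left as it is, or with columns scaled to length one. -/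
inductive Scaling
  | asGiven
  | unitColumns

/-- The rescaled design matrix. -/
def Scaling.apply : Scaling → Matrix n ι ℝ → Matrix n ι ℝ
  | .asGiven, X => X
  | .unitColumns, X => Matrix.of fun k j => X k j / √(∑ l, X l j ^ 2)

/-- The two strategies for choosing the vector `s`. -/
inductive Strategy
  | equi
  | sdp

/-- Equi-correlated choice: `s_j = min (2 λ_min(XᵀX), 1)` for all `j`, where `λ_min` is the
smallest eigenvalue. -/
def IsEqui (X : Matrix n ι ℝ) (s : ι → ℝ) : Prop :=
  ∀ j, s j = min (2 * sInf (spectrum ℝ (Xᵀ * X))) 1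

/-- The constraints `diag{s} ⪯ 2 XᵀX` and `0 ≤ s_j ≤ 1` of the semidefinite program. -/
def SDPFeasible (X : Matrix n ι ℝ) (s : ι → ℝ) : Prop :=
  ((2 : ℝ) • (Xᵀ * X) - diagonal s).PosSemidef ∧ ∀ j, 0 ≤ s j ∧ s j ≤ 1

/-- `s` minimizes `∑ (1 - s_j)` under the constraints of the semidefinite program. -/
def IsSDPSolution (X : Matrix n ι ℝ) (s : ι → ℝ) : Prop :=
  SDPFeasible X s ∧ ∀ s', SDPFeasible X s' → ∑ j, (1 - s j) ≤ ∑ j, (1 - s' j)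

/-- `s` is a result of the given strategy for the design matrix `X`. -/
def Strategy.Chooses : Strategy → Matrix n ι ℝ → (ι → ℝ) → Prop
  | .equi, X, s => IsEqui X s
  | .sdp, X, s => IsSDPSolution X s

/-- `K` is a rule that computes a knockoff matrix from a design matrix according to the given
strategy: it is measurable, and on every design matrix `X` with invertible `XᵀX` its value is
`X (I - (XᵀX)⁻¹ diag{s}) + U C`, where `s` is chosen by the strategy, `U` has orthonormal columns
orthogonal to those of `X`, and `CᵀC = 2 diag{s} - diag{s} (XᵀX)⁻¹ diag{s}`. -/
def IsKnockoffConstruction (O : Strategy) (K : Matrix n ι ℝ → Matrix n ι ℝ) : Prop :=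
  (Measurable fun X : n → ι → ℝ => (fun k j => K (Matrix.of X) k j : n → ι → ℝ)) ∧
  ∀ X : Matrix n ι ℝ, IsUnit (Xᵀ * X).det →
    ∃ (s : ι → ℝ) (U : Matrix n ι ℝ) (C : Matrix ι ι ℝ),
      O.Chooses X s ∧ Uᵀ * U = 1 ∧ Uᵀ * X = 0 ∧
      Cᵀ * C = (2 : ℝ) • diagonal s - diagonal s * (Xᵀ * X)⁻¹ * diagonal s ∧
      K X = X * (1 - (Xᵀ * X)⁻¹ * diagonal s) + U * C

/-- The Gram matrix of `[X X̃]`. -/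
def pairGram (X Xt : Matrix n ι ℝ) : Matrix (ι ⊕ ι) (ι ⊕ ι) ℝ :=
  (fromCols X Xt)ᵀ * fromCols X Xt

/-- `Xt` is a knockoff matrix for the design matrix `X` (which has an invertible Gram matrix):
it mimics the correlation structure of `X`. -/
def IsKnockoff (X Xt : Matrix n ι ℝ) : Prop :=
  IsUnit (Xᵀ * X).det ∧ ∃ s : ι → ℝ, (∀ j, 0 ≤ s j) ∧
    pairGram X Xt = fromBlocks (Xᵀ * X) (Xᵀ * X - diagonal s) (Xᵀ * X - diagonal s) (Xᵀ * X)

/-- A procedure that computes feature statistics from a design matrix, a knockoff matrix and a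
response vector. -/
abbrev FeatureProcedure (n ι : Type*) : Type _ :=
  Matrix n ι ℝ → Matrix n ι ℝ → (n → ℝ) → ι → ℝ

/-- Sufficiency: the statistics are a (measurable) function of the Gram matrix of `[X X̃]` and of
the inner products `[X X̃]ᵀ y`. -/
def FeatureProcedure.Sufficient (W : FeatureProcedure n ι) : Prop :=
  ∃ f : (ι ⊕ ι → ι ⊕ ι → ℝ) × (ι ⊕ ι → ℝ) → (ι → ℝ), Measurable f ∧
    ∀ X Xt y, IsKnockoff X Xt →
      W X Xt y = f (fun a b => pairGram X Xt a b, (fromCols X Xt)ᵀ *ᵥ y)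

open Classical in
/-- The columns of `X`, with those indexed by `H` replaced by the columns of `Xt`. -/
def swapIn (H : Set ι) (X Xt : Matrix n ι ℝ) : Matrix n ι ℝ :=
  Matrix.of fun k j => if j ∈ H then Xt k j else X k j

open Classical in
/-- Antisymmetry: swapping the columns of `X` and of `X̃` indexed by `H` switches the signs of the
statistics indexed by `H` (and of no others). -/
def FeatureProcedure.Antisymmetric (W : FeatureProcedure n ι) : Prop :=
  ∀ X Xt y, IsKnockoff X Xt → ∀ (H : Set ι) (j : ι),
    W (swapIn H X Xt) (swapIn H Xt X) y j = if j ∈ H then - W X Xt y j else W X Xt y j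

end LinearModel

/-! ### The feature statistic matrix of the graphical model -/

/-- The data matrix without its column `i`. -/
def deleteColumn {n p : ℕ} (X : Matrix (Fin n) (Fin p) ℝ) (i : Fin p) :
    Matrix (Fin n) {j : Fin p // j ≠ i} ℝ :=
  X.submatrix id Subtype.val

/-- The feature statistics `W i j = W^{(i)}_j`: column `i` of the data is the response, the other
columns (rescaled as prescribed) are the design, and `W^{(i)}_i = 0`. -/
def featureStatistics {n p : ℕ} (σ : Scaling)
    (K : ∀ i : Fin p, Matrix (Fin n) {j : Fin p // j ≠ i} ℝ →
      Matrix (Fin n) {j : Fin p // j ≠ i} ℝ)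
    (Pr : ∀ i : Fin p, FeatureProcedure (Fin n) {j : Fin p // j ≠ i})
    (X : Matrix (Fin n) (Fin p) ℝ) (i j : Fin p) : ℝ :=
  if h : j ≠ i then
    Pr i (σ.apply (deleteColumn X i)) (K i (σ.apply (deleteColumn X i))) (fun k => X k i) ⟨j, h⟩
  else 0

/-! ### The global threshold vector -/

section Threshold

variable {p : ℕ}

/-- The two rules for combining neighborhoods into an edge set. -/
inductive EdgeRule
  | and
  | or

/-- The undirected graph obtained from the neighborhoods `V i`. -/
def EdgeRule.graph : EdgeRule → (Fin p → Set (Fin p)) → SimpleGraph (Fin p)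
  | .and, V =>
    { Adj := fun i j => i ≠ j ∧ (i ∈ V j ∧ j ∈ V i)
      symm := ⟨fun _ _ h => ⟨h.1.symm, h.2.2, h.2.1⟩⟩
      loopless := ⟨fun _ h => h.1 rfl⟩ }
  | .or, V =>
    { Adj := fun i j => i ≠ j ∧ (i ∈ V j ∨ j ∈ V i)
      symm := ⟨fun _ _ h => ⟨h.1.symm, h.2.symm⟩⟩
      loopless := ⟨fun _ h => h.1 rfl⟩ }

/-- `V⁺ = {j : W_j ≥ t}`. -/
def Vplus (w : Fin p → ℝ) (t : EReal) : Set (Fin p) := {j | t ≤ (w j : EReal)}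

/-- `V⁻ = {j : W_j ≤ -t}`. -/
def Vminus (w : Fin p → ℝ) (t : EReal) : Set (Fin p) := {j | (w j : EReal) ≤ -t}

/-- The graph estimated from the statistics `W` with thresholds `T`. -/
def estimatedGraph (R : EdgeRule) (W : Fin p → Fin p → ℝ) (T : Fin p → EReal) :
    SimpleGraph (Fin p) :=
  R.graph fun i => Vplus (W i) (T i)

/-- Number of undirected edges. -/
def numEdges (G : SimpleGraph (Fin p)) : ℕ := G.edgeSet.ncard

/-- The right-hand side of the constraints: `2q / (c p)` for AND, `q / (c p)` for OR. -/
def EdgeRule.level (R : EdgeRule) (p : ℕ) (q c : ℝ) : ℝ :=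
  match R with
  | .and => 2 * q / (c * p)
  | .or => q / (c * p)

/-- Possible thresholds of a node: `({|W_j| : j} ∪ {+∞}) \ {0}`. -/
def candidates (w : Fin p → ℝ) : Set EReal :=
  (Set.range (fun j => ((|w j| : ℝ) : EReal)) ∪ {⊤}) \ {0}

/-- The constraints of the global optimization problem. -/
def Feasible (R : EdgeRule) (q a c : ℝ) (W : Fin p → Fin p → ℝ) (T : Fin p → EReal) : Prop :=
  ∀ i, T i ∈ candidates (W i) ∧
    (a + ((Vminus (W i) (T i)).ncard : ℝ)) / max (numEdges (estimatedGraph R W T) : ℝ) 1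
      ≤ R.level p q c

/-- `T` solves the global optimization problem: it maximizes the number of estimated edges among
the feasible vectors, and it is `(+∞, …, +∞)` if no vector is feasible. -/
def IsGlobalSolution (R : EdgeRule) (q a c : ℝ) (W : Fin p → Fin p → ℝ) (T : Fin p → EReal) :
    Prop :=
  (Feasible R q a c W T ∧ ∀ T', Feasible R q a c W T' →
      numEdges (estimatedGraph R W T') ≤ numEdges (estimatedGraph R W T)) ∨
  ((¬ ∃ T', Feasible R q a c W T') ∧ T = fun _ => ⊤)

/-- The largest integer `≤ q (p - 1) / c - a` (AND) or `≤ q (p - 1) / (2 c) - a` (OR). -/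
def EdgeRule.mMax (R : EdgeRule) (p : ℕ) (q a c : ℝ) : ℤ :=
  match R with
  | .and => ⌊q * ((p : ℝ) - 1) / c - a⌋
  | .or => ⌊q * ((p : ℝ) - 1) / (2 * c) - a⌋

/-- For each node, the smallest candidate threshold `t` with `|V⁻(t)| ≤ m` (the infimum is attained
because the set is finite and contains `+∞`). -/
def levelThreshold (W : Fin p → Fin p → ℝ) (m : ℕ) (i : Fin p) : EReal :=
  sInf {t | t ∈ candidates (W i) ∧ (Vminus (W i) t).ncard ≤ m}

open Classical in
/-- The threshold algorithm: run through `m = mMax, mMax - 1, …, 0` and return the first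
`levelThreshold W m` that satisfies the constraints; return `(+∞, …, +∞)` if there is none
(in particular if `mMax < 0`). -/
def thresholdAlgorithm (R : EdgeRule) (q a c : ℝ) (W : Fin p → Fin p → ℝ) : Fin p → EReal :=
  match (List.range (R.mMax p q a c + 1).toNat).reverse.find?
      (fun m => decide (Feasible R q a c W (levelThreshold W m))) with
  | some m => levelThreshold W m
  | none => fun _ => ⊤

/-- False discovery proportion of the estimated graph `Ghat` with respect to the true graph `G`. -/
def fdp (G Ghat : SimpleGraph (Fin p)) : ℝ :=
  ((Ghat.edgeSet \ G.edgeSet).ncard : ℝ) / max (numEdges Ghat : ℝ) 1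

end Threshold

end GGMKnockoff

end

open GGMKnockoff

noncomputable section

namespace GGMKnockoff

/-! ### The largest ratio of positive and negative signs -/

section SignWalk

variable {ι : Type*}

/-! The proof isolates one node at a time. For node `i`, let `N` be the set of non-neighbours and
let `nullRatio` be the largest value, over all thresholds t, of the ratio of #{j ∈ N : W_j ≥ t} to a
+ #{j ∈ N : W_j ≤ -t}. A false edge {i, j} puts j into the null part of V_i⁺ or i into that of V_j⁺,
and does both under AND; feasibility bounds a + |V_i⁻| by r (|Ê| ∨ 1). So the false discovery
proportion of every feasible T is at most r / μ times the sum of the `nullRatio`s, with μ = 2 for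
AND and μ = 1 for OR (`fdp_le_of_feasible`). The supremum over t absorbs the dependence of the
thresholds on the data and on the other nodes. It remains to show that each `nullRatio` has
expectation at most c_a, since r p c_a / μ = q.

Sign symmetry (`signSymmetric_featureStatistics`). The form (Ωx)_i is uncorrelated with, hence
independent of, the coordinates other than i. So column i follows a linear model in the other
columns, with coefficients -Ω_ij / Ω_ii and independent Gaussian noise. Conditional independence of
i and j forces Ω_ij = 0 (`precision_eq_zero_of_condIndep`). With the design fixed, swapping null
columns with their knockoffs changes neither the Gram matrix nor the law of the inner products with
the response; by sufficiency and antisymmetry the null signs may therefore be flipped at will.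

The constant (`sum_maxRatio_le`). Averaging over flips turns the null signs into independent fair
coins, read in order of decreasing magnitude. With h heads and t tails so far, the maximum of h / (1
+ t) exceeds a / b exactly when the walk satisfies b h > a (1 + t) at some level. The martingale (2
- u)^h u^(1 + t) is at least 1 there if u^b (2 - u)^a ≥ 1, so it dominates the crossing probability
from each state. These bounds, inserted after 24 tosses and pulled back by the exact recursion, are
summed over a grid of levels: the expected maximum is at most 1 + 0.929 + 0.001 = 1.93. For the
offset 0.01, splitting on the first coin gives 1 / 0.01 + 1.93 ≤ 102. -/

theorem filter_le_eq_empty {v : ι → ℝ} {s : Finset ι} {i : ι} (hmax : ∀ x ∈ s, v x ≤ v i) {r : ℝ}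
    (hr : v i < r) {A : Finset ι} (hA : A ⊆ s) : (A.filter fun i => r ≤ v i) = ∅ := by
  refine Finset.filter_eq_empty_iff.2 fun x hx h => ?_
  linarith [hmax x (hA hx)]

variable [DecidableEq ι]

/-- Some level `r` of the magnitudes `v` satisfies `b (h + H) > a (1 + t + T)`, where `H` and `T`
count the elements of magnitude at least `r` with positive and with negative signs; `A` is the set
of elements with a positive sign. -/
def Crosses (a b : ℕ) (v : ι → ℝ) (s A : Finset ι) (h t : ℕ) : Prop :=
  ∃ r : ℝ, a * (1 + t + ((s \ A).filter fun i => r ≤ v i).card) <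
    b * (h + (A.filter fun i => r ≤ v i).card)

open Classical in
/-- The number of sign patterns that cross. -/
def crossCount (a b : ℕ) (v : ι → ℝ) (s : Finset ι) (h t : ℕ) : ℝ :=
  ∑ A ∈ s.powerset, if Crosses a b v s A h t then 1 else 0

theorem crossCount_le_two_pow (a b : ℕ) (v : ι → ℝ) (s : Finset ι) (h t : ℕ) :
    crossCount a b v s h t ≤ 2 ^ s.card := by
  classical
  unfold crossCount
  calc _ ≤ ∑ A ∈ s.powerset, (1 : ℝ) := Finset.sum_le_sum fun A _ => by split_ifs <;> norm_num
    _ = _ := by simp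

theorem insert_sdiff_insert_of_notMem {s A : Finset ι} {i : ι} (hi : i ∉ s) :
    insert i s \ insert i A = s \ A := by
  ext x
  simp only [Finset.mem_sdiff, Finset.mem_insert]
  by_cases h : x = i
  · subst h; simp [hi]
  · simp [h]

theorem insert_sdiff_of_subset {s A : Finset ι} {i : ι} (hi : i ∉ s) (hA : A ⊆ s) :
    insert i s \ A = insert i (s \ A) :=
  Finset.insert_sdiff_of_notMem _ fun h => hi (hA h)

theorem card_filter_insert_of_le {v : ι → ℝ} {A : Finset ι} {i : ι} (hi : i ∉ A) {r : ℝ}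
    (hr : r ≤ v i) :
    ((insert i A).filter fun i => r ≤ v i).card = (A.filter fun i => r ≤ v i).card + 1 := by
  rw [Finset.filter_insert, if_pos hr, Finset.card_insert_of_notMem (by simp [hi])]

/-- Conditioning on the coin of the largest magnitude, which is tossed first: a head leads to the
state (h + 1, t), a tail to (h, t + 1). -/
theorem crossCount_insert_le {a b : ℕ} {v : ι → ℝ} {s : Finset ι} {i : ι} (hi : i ∉ s)
    (hmax : ∀ x ∈ s, v x ≤ v i) {h t : ℕ} (hn : ¬ a * (1 + t) < b * h) :
    crossCount a b v (insert i s) h t ≤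
      crossCount a b v s (h + 1) t + crossCount a b v s h (t + 1) := by
  classical
  unfold crossCount
  rw [Finset.sum_powerset_insert hi, add_comm]
  refine add_le_add (Finset.sum_le_sum fun A hA => ?_) (Finset.sum_le_sum fun A hA => ?_)
  all_goals
    rw [Finset.mem_powerset] at hA
    have hiA : i ∉ A := fun h => hi (hA h)
    have key : ∀ P Q : Prop, (P → Q) → (if P then (1 : ℝ) else 0) ≤ if Q then 1 else 0 := by
      intro P Q hPQ
      by_cases hP : P
      · simp [hP, hPQ hP]
      · simp only [hP, if_false]; split_ifs <;> norm_num
    apply key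
    rintro ⟨r, hr⟩
    by_cases hri : r ≤ v i
  -- Four cases: the sign of `i`, and whether the level `r` reaches down to `v i`. Above `v i`
  -- nothing is counted, so a crossing would already be one of the state (h, t), contrary to `hn`.
  · refine ⟨r, ?_⟩
    rw [insert_sdiff_insert_of_notMem hi, card_filter_insert_of_le hiA hri] at hr
    convert hr using 2; ring
  · push Not at hri
    rw [insert_sdiff_insert_of_notMem hi, Finset.filter_insert, if_neg (not_le.2 hri),
      filter_le_eq_empty hmax hri hA, filter_le_eq_empty hmax hri Finset.sdiff_subset] at hr
    simp at hr; omega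
  · refine ⟨r, ?_⟩
    rw [insert_sdiff_of_subset hi hA, card_filter_insert_of_le (by simp [hi]) hri] at hr
    convert hr using 2; ring
  · push Not at hri
    rw [insert_sdiff_of_subset hi hA, Finset.filter_insert, if_neg (not_le.2 hri),
      filter_le_eq_empty hmax hri hA, filter_le_eq_empty hmax hri Finset.sdiff_subset] at hr
    simp at hr; omega

theorem crossCount_empty_of_not_lt {a b : ℕ} {v : ι → ℝ} {h t : ℕ} (hn : ¬ a * (1 + t) < b * h) :
    crossCount a b v ∅ h t = 0 := by
  unfold crossCount Crosses
  simpa using hn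

theorem exists_eq_insert_max (v : ι → ℝ) {s : Finset ι} (hs : s.Nonempty) :
    ∃ i s', i ∉ s' ∧ s = insert i s' ∧ ∀ x ∈ s', v x ≤ v i := by
  obtain ⟨i, his, hmax⟩ := s.exists_max_image v hs
  exact ⟨i, s.erase i, by simp, (Finset.insert_erase his).symm,
    fun x hx => hmax x (Finset.mem_of_mem_erase hx)⟩

/-- One step of the recursion for bounds of crossing frequencies. -/
theorem crossCount_le_step {a b h t : ℕ} {v : ι → ℝ} {x y : ℝ}
    (hx : ∀ s, crossCount a b v s (h + 1) t ≤ 2 ^ s.card * x)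
    (hy : ∀ s, crossCount a b v s h (t + 1) ≤ 2 ^ s.card * y) (hn : ¬ a * (1 + t) < b * h)
    (hxy : 0 ≤ x + y) (s : Finset ι) :
    crossCount a b v s h t ≤ 2 ^ s.card * ((x + y) / 2) := by
  rcases s.eq_empty_or_nonempty with rfl | hs
  · rw [crossCount_empty_of_not_lt hn]; simpa using by linarith
  · obtain ⟨i, s', hi, rfl, hmax⟩ := exists_eq_insert_max v hs
    refine (crossCount_insert_le hi hmax hn).trans ?_
    rw [Finset.card_insert_of_notMem hi, pow_succ]
    linarith [hx s', hy s']

/-- Exponential bound for crossing frequencies. -/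
theorem crossCount_le_exp {a b : ℕ} (hb : 0 < b) {u : ℝ} (hu0 : 0 ≤ u) (hu1 : u ≤ 1)
    (hu : 1 ≤ u ^ b * (2 - u) ^ a) (v : ι → ℝ) (s : Finset ι) (h t : ℕ) :
    crossCount a b v s h t ≤ 2 ^ s.card * ((2 - u) ^ h * u ^ (1 + t)) := by
  have hw : 1 ≤ 2 - u := by linarith
  have hw0 : 0 ≤ 2 - u := by linarith
  -- The bound is at least 1 in every state past the line; this is seen on its `b`-th power, where b
  -- h may be replaced by a (1 + t) because 2 - u ≥ 1.
  have cross : ∀ h t : ℕ, a * (1 + t) < b * h → 1 ≤ (2 - u) ^ h * u ^ (1 + t) := by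
    intro h t hlt
    have h0 : 0 ≤ (2 - u) ^ h * u ^ (1 + t) := by positivity
    refine (one_le_pow_iff_of_nonneg h0 hb.ne').1 ?_
    calc (1 : ℝ) ≤ (u ^ b * (2 - u) ^ a) ^ (1 + t) := one_le_pow₀ hu
      _ = (2 - u) ^ (a * (1 + t)) * u ^ (b * (1 + t)) := by
        rw [mul_pow, ← pow_mul, ← pow_mul]; ring
      _ ≤ (2 - u) ^ (b * h) * u ^ (b * (1 + t)) := by
        gcongr
      _ = _ := by rw [mul_pow, ← pow_mul, ← pow_mul, mul_comm b h, mul_comm b (1 + t)]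
  induction hc : s.card generalizing s h t with
  | zero =>
    by_cases hlt : a * (1 + t) < b * h
    · have := crossCount_le_two_pow a b v s h t
      rw [hc] at this
      simpa using (by simpa using this : _ ≤ (1:ℝ)).trans (cross h t hlt)
    · rw [Finset.card_eq_zero] at hc
      subst hc
      rw [crossCount_empty_of_not_lt hlt]
      positivity
  | succ m ih =>
    by_cases hlt : a * (1 + t) < b * h
    · have := crossCount_le_two_pow a b v s h t
      rw [hc] at this
      exact this.trans (le_mul_of_one_le_right (by positivity) (cross h t hlt))
    · obtain ⟨i, s', hi, rfl, hmax⟩ := exists_eq_insert_max v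
        (Finset.card_pos.1 (by rw [hc]; exact m.succ_pos) : s.Nonempty)
      rw [Finset.card_insert_of_notMem hi] at hc
      have h1 := ih s' (h + 1) t (by omega)
      have h2 := ih s' h (t + 1) (by omega)
      -- The factors 2 - u (head) and u (tail) average to one, so the bound reproduces itself.
      refine (crossCount_insert_le hi hmax hlt).trans ((add_le_add h1 h2).trans (le_of_eq ?_))
      ring

/-! #### Evaluation of the recursion -/

/-- Backward step of the recursion for crossing frequencies, on scaled values: `one` represents
frequency one, and the entries belong to the states `(h, n - h), (h + 1, n - h - 1), …`. -/
def layerStep (a b one n : ℕ) : ℕ → List ℕ → List ℕ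
  | h, x :: y :: l =>
    (if a * (1 + n) < (a + b) * h then one else x + y) :: layerStep a b one n (h + 1) (y :: l)
  | _, _ => []

/-- Backward recursion from a layer `n` to the starting state. -/
def layerValue (a b : ℕ) : ℕ → ℕ → List ℕ → ℕ
  | 0, _, l => l.headD 0
  | n + 1, one, l => layerValue a b n (2 * one) (layerStep a b (2 * one) n 0 l)

/-- Scaled exponential bounds with `u = k / 1000` for the states with `h + t = n`. -/
def terminalLayer (k n : ℕ) : List ℕ :=
  (List.range (n + 1)).map fun h => (2000 - k) ^ h * k ^ (1 + (n - h))

/-- Scaled bound for the crossing frequency, with `d` steps of the recursion. -/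
def scaledBound (d a b k : ℕ) : ℕ :=
  layerValue a b d (1000 ^ (d + 1)) (terminalLayer k d)

/-- Sum of the bounds for `a = a₀, a₀ + 1, …`. -/
def scaledSum (d b : ℕ) : ℕ → List ℕ → ℕ
  | _, [] => 0
  | a, k :: l => scaledBound d a b k + scaledSum d b (a + 1) l

/-- The parameters of the exponential bounds are admissible. -/
def admissible (b : ℕ) : ℕ → List ℕ → Bool
  | _, [] => true
  | a, k :: l => Nat.ble k 1000 && Nat.ble (1000 ^ (a + b)) (k ^ b * (2000 - k) ^ a) &&
      admissible b (a + 1) l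

/-- Values of 1000 u, close to the least admissible u for each level a / b. The four lists cover the
levels from 1 to 2 in steps of 1/60, from 2 to 4 in steps of 1/20, from 4 to 8 in steps of 1/4 and
from 8 to 12 in steps of 1. -/
def params₁ : List ℕ := [1000, 984, 968, 952, 936, 921, 905, 890, 876, 861, 847, 833, 820, 806,
  793, 780, 767, 755, 743, 731, 719, 707, 696, 684, 673, 662, 652, 641, 631, 621, 611, 601, 592,
  582, 573, 564, 555, 546, 538, 529, 521, 513, 505, 497, 489, 482, 474, 467, 460, 453, 446, 439,
  432, 426, 419, 413, 406, 400, 394, 388]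

def params₂ : List ℕ := [382, 365, 349, 334, 319, 306, 292, 280, 268, 256, 246, 235, 225, 216, 207,
  199, 190, 183, 175, 168, 161, 155, 149, 143, 137, 131, 126, 121, 117, 112, 108, 104, 100, 96, 92,
  88, 85, 82, 79, 76]

def params₃ : List ℕ := [73, 60, 50, 42, 35, 29, 24, 20, 17, 14, 12, 10, 9, 7, 6, 5]

def params₄ : List ℕ := [4, 2, 1, 1]

theorem admissible_params : (admissible 60 60 params₁ && admissible 20 40 params₂ &&
    admissible 4 16 params₃ && admissible 1 8 params₄) = true := by
  decide +kernel

/-- With S₁, …, S₄ the four sums divided by the scale 2^24 * 1000^25, this is S₁/60 + S₂/20 + S₃/4 +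
S₄ ≤ 0.929 without denominators. -/
theorem scaledSum_params : Nat.ble
    (1000 * (scaledSum 24 60 60 params₁ + 3 * scaledSum 24 20 40 params₂ +
    15 * scaledSum 24 4 16 params₃ + 60 * scaledSum 24 1 8 params₄))
    (60 * 929 * (2 ^ 24 * 1000 ^ (24 + 1))) = true := by
  decide +kernel

/-- The list `l` contains scaled bounds for the states `(h, n - h), (h + 1, n - h - 1), …`. -/
def BoundsLayer (a b : ℕ) (v : ι → ℝ) (one n h : ℕ) (l : List ℕ) : Prop :=
  ∀ k (hk : k < l.length), h + k ≤ n ∧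
    ∀ s, crossCount a b v s (h + k) (n - (h + k)) ≤ 2 ^ s.card * ((l[k] : ℝ) / one)

theorem BoundsLayer.tail {a b : ℕ} {v : ι → ℝ} {one n h x : ℕ} {l : List ℕ}
    (hl : BoundsLayer a b v one n h (x :: l)) : BoundsLayer a b v one n (h + 1) l := by
  intro k hk
  have := hl (k + 1) (by simpa using hk)
  rw [show h + 1 + k = h + (k + 1) by ring]
  simpa using this

/-- A state past the line crosses with frequency one; any other state averages its two successors on
the next layer. Doubling `one` stands for the division by two. -/
theorem boundsLayer_layerStep {a b : ℕ} {v : ι → ℝ} {one n : ℕ} (hone : 0 < one) (l : List ℕ) :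
    ∀ h, BoundsLayer a b v one (n + 1) h l →
      BoundsLayer a b v (2 * one) n h (layerStep a b (2 * one) n h l) := by
  induction l with
  | nil => intro h _ k hk; simp [layerStep] at hk
  | cons x l ih =>
    cases l with
    | nil => intro h _ k hk; simp [layerStep] at hk
    | cons y l =>
      intro h hl k hk
      cases k with
      | zero =>
        obtain ⟨h0, h1⟩ := hl 0 (by simp)
        obtain ⟨h2, h3⟩ := hl 1 (by simp)
        simp only [add_zero, List.getElem_cons_zero, List.getElem_cons_succ] at h0 h1 h3
        have hhn : h ≤ n := by omega
        refine ⟨by omega, fun s => ?_⟩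
        simp only [layerStep, add_zero, List.getElem_cons_zero]
        have hone' : (0 : ℝ) < one := by exact_mod_cast hone
        -- The test in `layerStep` is the crossing condition with t = n - h substituted and a h
        -- added to both sides.
        have hiff : a * (1 + n) < (a + b) * h ↔ a * (1 + (n - h)) < b * h := by
          obtain ⟨m, rfl⟩ := Nat.exists_eq_add_of_le hhn
          rw [Nat.add_sub_cancel_left]
          constructor <;> intro hh <;> nlinarith
        split_ifs with hc
        · refine (crossCount_le_two_pow ..).trans (le_of_eq ?_)
          push_cast
          field_simp
        · have := crossCount_le_step (a := a) (b := b) (h := h) (t := n - h) (v := v) (x := y / one)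
            (y := x / one) (by simpa only [show n + 1 - (h + 1) = n - h by omega] using h3)
            (by rwa [show n - h + 1 = n + 1 - h by omega]) (by rwa [← hiff])
            (by positivity) s
          refine this.trans (le_of_eq ?_)
          push_cast
          field_simp
          ring
      | succ k =>
        have := ih (h + 1) hl.tail k (by simpa [layerStep] using hk)
        rw [show h + (k + 1) = h + 1 + k by ring]
        simpa [layerStep] using this

theorem crossCount_le_layerValue {a b : ℕ} {v : ι → ℝ} (n : ℕ) :
    ∀ {one : ℕ} {l : List ℕ}, 0 < one → l.length = n + 1 → BoundsLayer a b v one n 0 l →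
      ∀ s, crossCount a b v s 0 0 ≤ 2 ^ s.card * ((layerValue a b n one l : ℝ) / (2 ^ n * one)) := by
  have hlen : ∀ (one n h : ℕ) (l : List ℕ), (layerStep a b one n h l).length = l.length - 1 := by
    intro one n h l
    induction l generalizing h with
    | nil => simp [layerStep]
    | cons x l ih =>
      cases l with
      | nil => simp [layerStep]
      | cons y l => simpa [layerStep] using ih (h + 1)
  induction n with
  | zero =>
    intro one l hone hl hb s
    obtain ⟨x, rfl⟩ := List.length_eq_one_iff.1 hl
    simpa [layerValue] using (hb 0 (by simp)).2 s
  | succ n ih =>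
    intro one l hone hl hb s
    have := ih (one := 2 * one) (by omega) (by rw [hlen, hl]; rfl)
      (boundsLayer_layerStep hone l 0 hb) s
    rw [layerValue]
    convert this using 3
    push_cast
    ring

/-- The exponential bounds with u = k / 1000 on layer `d`, all over the common denominator 1000^(d +
1), start the recursion, which adds the factor 2^d. -/
theorem crossCount_le_scaledBound {d a b k : ℕ} (hb : 0 < b) (hk : k ≤ 1000)
    (hu : 1000 ^ (a + b) ≤ k ^ b * (2000 - k) ^ a) (v : ι → ℝ) (s : Finset ι) :
    crossCount a b v s 0 0 ≤ 2 ^ s.card *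
      ((scaledBound d a b k : ℝ) / (2 ^ d * 1000 ^ (d + 1))) := by
  have hw : (2 - (k : ℝ) / 1000) = ((2000 - k : ℕ) : ℝ) / 1000 := by
    rw [Nat.cast_sub (by omega)]; push_cast; ring
  have hu' : 1 ≤ ((k : ℝ) / 1000) ^ b * (2 - (k : ℝ) / 1000) ^ a := by
    rw [hw, div_pow, div_pow, div_mul_div_comm, ← pow_add, add_comm b a, le_div_iff₀ (by positivity),
      one_mul]
    exact_mod_cast hu
  have := crossCount_le_layerValue (a := a) (b := b) (v := v) d
    (one := 1000 ^ (d + 1)) (l := terminalLayer k d) (by positivity)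
    (by simp [terminalLayer]) ?_ s
  · simpa [scaledBound] using this
  · intro j hj
    simp only [terminalLayer, List.length_map, List.length_range] at hj
    refine ⟨by omega, fun s => ?_⟩
    refine (crossCount_le_exp hb (u := (k : ℝ) / 1000) (by positivity)
      (by rw [div_le_one (by norm_num)]; exact_mod_cast hk) hu' v s _ _).trans (le_of_eq ?_)
    simp only [terminalLayer, List.getElem_map, List.getElem_range, zero_add]
    rw [hw, div_pow, div_pow, div_mul_div_comm, ← pow_add]
    push_cast
    congr 3
    omega

theorem sum_crossCount_le_scaledSum {d b : ℕ} (hb : 0 < b) (v : ι → ℝ) (s : Finset ι)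
    (l : List ℕ) : ∀ a, admissible b a l = true →
      ∑ i ∈ Finset.range l.length, crossCount (a + i) b v s 0 0 ≤ 2 ^ s.card *
        ((scaledSum d b a l : ℝ) / (2 ^ d * 1000 ^ (d + 1))) := by
  induction l with
  | nil => intro a _; simp [scaledSum]
  | cons k l ih =>
    intro a hl
    simp only [admissible, Bool.and_eq_true, Nat.ble_eq] at hl
    rw [List.length_cons, Finset.sum_range_succ', scaledSum]
    have h1 := ih (a + 1) hl.2
    have h2 := crossCount_le_scaledBound (d := d) hb hl.1.1 hl.1.2 v s
    push_cast
    rw [add_div, mul_add, add_comm (2 ^ s.card * _)]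
    refine add_le_add ?_ h2
    refine (Finset.sum_congr rfl fun i _ => ?_).trans_le h1
    rw [show a + (i + 1) = a + 1 + i by ring]

/-! #### Expected largest ratio -/

/-- The largest ratio of the number of positive signs (plus `h`) and the number of negative signs
(plus `c`) among the elements whose magnitude exceeds some level. -/
def maxRatio (v : ι → ℝ) (s A : Finset ι) (h c : ℝ) : ℝ :=
  ⨆ r : ℝ, (h + (A.filter fun i => r ≤ v i).card) / (c + ((s \ A).filter fun i => r ≤ v i).card)

theorem ratio_le {v : ι → ℝ} {s A : Finset ι} {h c : ℝ} (hA : A ⊆ s) (hh : 0 ≤ h) (hc : 0 < c)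
    (r : ℝ) : (h + (A.filter fun i => r ≤ v i).card) /
      (c + ((s \ A).filter fun i => r ≤ v i).card) ≤ (h + s.card) / c := by
  have : ((A.filter fun i => r ≤ v i).card : ℝ) ≤ s.card := by
    exact_mod_cast (Finset.card_filter_le _ _).trans (Finset.card_le_card hA)
  gcongr
  simp

/-- `maxRatio` is a supremum of reals, so it dominates its terms only once boundedness is known. -/
theorem bddAbove_ratio (v : ι → ℝ) {s A : Finset ι} {h c : ℝ} (hA : A ⊆ s) (hh : 0 ≤ h)
    (hc : 0 < c) : BddAbove (Set.range fun r : ℝ => (h + (A.filter fun i => r ≤ v i).card) /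
      (c + ((s \ A).filter fun i => r ≤ v i).card)) := by
  refine ⟨(h + s.card) / c, ?_⟩
  rintro _ ⟨r, rfl⟩
  exact ratio_le hA hh hc r

theorem ratio_le_maxRatio (v : ι → ℝ) {s A : Finset ι} {h c : ℝ} (hA : A ⊆ s) (hh : 0 ≤ h)
    (hc : 0 < c) (r : ℝ) : (h + (A.filter fun i => r ≤ v i).card) /
      (c + ((s \ A).filter fun i => r ≤ v i).card) ≤ maxRatio v s A h c :=
  le_ciSup (bddAbove_ratio v hA hh hc) r

theorem maxRatio_le_card (v : ι → ℝ) {s A : Finset ι} (hA : A ⊆ s) :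
    maxRatio v s A 0 1 ≤ s.card :=
  ciSup_le fun r => (ratio_le hA le_rfl one_pos r).trans (by simp)

theorem maxRatio_nonneg (v : ι → ℝ) {s A : Finset ι} {h c : ℝ} (hA : A ⊆ s) (hh : 0 ≤ h)
    (hc : 0 < c) : 0 ≤ maxRatio v s A h c :=
  le_trans (by positivity) (ratio_le_maxRatio v hA hh hc 0)

theorem crosses_of_lt_maxRatio {a b : ℕ} (hb : 0 < b) {v : ι → ℝ} {s A : Finset ι}
    (h : (a : ℝ) / b < maxRatio v s A 0 1) : Crosses a b v s A 0 0 := by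
  obtain ⟨r, hr⟩ := exists_lt_of_lt_ciSup h
  refine ⟨r, ?_⟩
  rw [div_lt_div_iff₀ (by positivity) (by positivity)] at hr
  have : (a : ℝ) * (1 + 0 + ((s \ A).filter fun i => r ≤ v i).card) <
      b * (0 + (A.filter fun i => r ≤ v i).card) := by linarith
  exact_mod_cast this

-- Discrete layer-cake formula: raising the cap from one grid point to the next, 1/b further, gains
-- at most 1/b, and gains nothing unless the ratio exceeds the lower grid point.
open Classical in
theorem min_le_add_crosses {b : ℕ} (hb : 0 < b) (v : ι → ℝ) (s A : Finset ι) (a m : ℕ) :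
    min (maxRatio v s A 0 1) (((a + m : ℕ) : ℝ) / b) ≤ min (maxRatio v s A 0 1) ((a : ℝ) / b) +
      1 / b * ∑ i ∈ Finset.range m, if Crosses (a + i) b v s A 0 0 then 1 else 0 := by
  have hb' : (0 : ℝ) < b := by exact_mod_cast hb
  induction m with
  | zero => simp
  | succ m ih =>
    rw [Finset.sum_range_succ, mul_add, ← add_assoc]
    split_ifs with hc
    · have h1 : (((a + m + 1 : ℕ) : ℝ) / b) = ((a + m : ℕ) : ℝ) / b + 1 / b := by
        push_cast; ring
      have h2 : min (maxRatio v s A 0 1) (((a + m : ℕ) : ℝ) / b + 1 / b) ≤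
          min (maxRatio v s A 0 1) (((a + m : ℕ) : ℝ) / b) + 1 / b := by
        have : (0 : ℝ) < 1 / b := by positivity
        rw [← min_add_add_right]
        exact min_le_min (by linarith) le_rfl
      rw [h1, mul_one]
      linarith
    · have h1 : maxRatio v s A 0 1 ≤ ((a + m : ℕ) : ℝ) / b := by
        by_contra hlt
        exact hc (crosses_of_lt_maxRatio hb (not_le.1 hlt))
      rw [min_eq_left h1] at ih
      have := min_le_left (maxRatio v s A 0 1) (((a + m + 1 : ℕ) : ℝ) / b)
      rw [mul_zero, add_zero]
      exact this.trans ih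

theorem sum_min_le {b : ℕ} (hb : 0 < b) (v : ι → ℝ) (s : Finset ι) (a m : ℕ) :
    ∑ A ∈ s.powerset, min (maxRatio v s A 0 1) (((a + m : ℕ) : ℝ) / b) ≤
      ∑ A ∈ s.powerset, min (maxRatio v s A 0 1) ((a : ℝ) / b) +
      1 / b * ∑ i ∈ Finset.range m, crossCount (a + i) b v s 0 0 := by
  classical
  unfold crossCount
  rw [Finset.sum_comm, Finset.mul_sum, ← Finset.sum_add_distrib]
  refine Finset.sum_le_sum fun A _ => ?_
  convert min_le_add_crosses hb v s A a m

/-- For integer levels a ≥ 12 the choice u = 1.96^(-a) is so small that 2 - u ≥ 1.96, hence u (2 -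
u)^a ≥ 1. The crossing frequencies are then bounded by a geometric series. -/
theorem sum_crossCount_tail_le (v : ι → ℝ) (s : Finset ι) (m : ℕ) :
    ∑ i ∈ Finset.range m, crossCount (12 + i) 1 v s 0 0 ≤ 2 ^ s.card * (1 / 1000) := by
  have h1 : ∀ i, crossCount (12 + i) 1 v s 0 0 ≤ 2 ^ s.card * ((1 / 1.96) ^ 12 * (1 / 1.96) ^ i) := by
    intro i
    have hpow : ((1 : ℝ) / 1.96) ^ (12 + i) ≤ 0.04 := by
      refine (pow_le_pow_of_le_one (by norm_num) (by norm_num) (by omega : 12 ≤ 12 + i)).trans ?_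
      norm_num
    have := crossCount_le_exp (a := 12 + i) (b := 1) one_pos (u := (1 / 1.96) ^ (12 + i))
      (by positivity) (hpow.trans (by norm_num)) ?_ v s 0 0
    · simpa [pow_add] using this
    · calc (1 : ℝ) = ((1 / 1.96) ^ (12 + i)) ^ 1 * 1.96 ^ (12 + i) := by
            rw [pow_one, ← mul_pow]; norm_num
        _ ≤ _ := by gcongr; linarith
  refine (Finset.sum_le_sum fun i _ => h1 i).trans ?_
  rw [← Finset.mul_sum, ← Finset.mul_sum]
  have h2 : ∑ i ∈ Finset.range m, ((1 : ℝ) / 1.96) ^ i ≤ (1 - 1 / 1.96)⁻¹ := by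
    rw [← tsum_geometric_of_lt_one (by norm_num) (by norm_num)]
    exact (summable_geometric_of_lt_one (by norm_num) (by norm_num)).sum_le_tsum _
      fun i _ => by positivity
  gcongr
  calc ((1 : ℝ) / 1.96) ^ 12 * ∑ i ∈ Finset.range m, ((1 : ℝ) / 1.96) ^ i
      ≤ (1 / 1.96) ^ 12 * (1 - 1 / 1.96)⁻¹ := by gcongr
    _ ≤ 1 / 1000 := by norm_num

/-- The expected largest ratio for independent fair signs is at most `1.93`. -/
theorem sum_maxRatio_le (v : ι → ℝ) (s : Finset ι) :
    ∑ A ∈ s.powerset, maxRatio v s A 0 1 ≤ 2 ^ s.card * 1.93 := by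
  have hadm := admissible_params
  simp only [Bool.and_eq_true] at hadm
  have hnum : 1000 * ((scaledSum 24 60 60 params₁ : ℝ) + 3 * scaledSum 24 20 40 params₂ +
      15 * scaledSum 24 4 16 params₃ + 60 * scaledSum 24 1 8 params₄) ≤
      60 * 929 * (2 ^ 24 * 1000 ^ (24 + 1)) := by
    exact_mod_cast Nat.le_of_ble_eq_true scaledSum_params
  -- Below level 1 no tail estimate is used: the ratio capped at 1 contributes at most 1.
  have m0 : ∑ A ∈ s.powerset, min (maxRatio v s A 0 1) (((60 : ℕ) : ℝ) / (60 : ℕ)) ≤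
      2 ^ s.card * 1 := by
    refine (Finset.sum_le_sum fun A _ => min_le_right _ _).trans (le_of_eq ?_)
    simp
  have m1 := sum_min_le (b := 60) (by norm_num) v s 60 params₁.length
  have m2 := sum_min_le (b := 20) (by norm_num) v s 40 params₂.length
  have m3 := sum_min_le (b := 4) (by norm_num) v s 16 params₃.length
  have m4 := sum_min_le (b := 1) (by norm_num) v s 8 params₄.length
  have m5 := sum_min_le (b := 1) (by norm_num) v s 12 s.card
  have c1 := sum_crossCount_le_scaledSum (d := 24) (b := 60) (by norm_num) v s params₁ 60 hadm.1.1.1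
  have c2 := sum_crossCount_le_scaledSum (d := 24) (b := 20) (by norm_num) v s params₂ 40 hadm.1.1.2
  have c3 := sum_crossCount_le_scaledSum (d := 24) (b := 4) (by norm_num) v s params₃ 16 hadm.1.2
  have c4 := sum_crossCount_le_scaledSum (d := 24) (b := 1) (by norm_num) v s params₄ 8 hadm.2
  have c5 := sum_crossCount_tail_le v s s.card
  -- The ratio never exceeds the number of coins, so the cap 12 + |s| is inactive.
  have e5 : ∑ A ∈ s.powerset, maxRatio v s A 0 1 =
      ∑ A ∈ s.powerset, min (maxRatio v s A 0 1) (((12 + s.card : ℕ) : ℝ) / (1 : ℕ)) := by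
    refine Finset.sum_congr rfl fun A hA => (min_eq_left ?_).symm
    refine (maxRatio_le_card v (Finset.mem_powerset.1 hA)).trans ?_
    push_cast
    linarith
  rw [show (((60 + params₁.length : ℕ) : ℝ) / (60 : ℕ)) = 2 by norm_num [params₁]] at m1
  rw [show (((40 + params₂.length : ℕ) : ℝ) / (20 : ℕ)) = 4 by norm_num [params₂],
    show (((40 : ℕ) : ℝ) / (20 : ℕ)) = 2 by norm_num] at m2
  rw [show (((16 + params₃.length : ℕ) : ℝ) / (4 : ℕ)) = 8 by norm_num [params₃],
    show (((16 : ℕ) : ℝ) / (4 : ℕ)) = 4 by norm_num] at m3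
  rw [show (((8 + params₄.length : ℕ) : ℝ) / (1 : ℕ)) = 12 by norm_num [params₄],
    show (((8 : ℕ) : ℝ) / (1 : ℕ)) = 8 by norm_num] at m4
  rw [show (((12 : ℕ) : ℝ) / (1 : ℕ)) = 12 by norm_num] at m5
  rw [e5]
  set D : ℝ := 2 ^ 24 * 1000 ^ (24 + 1) with hD
  have hDpos : 0 < D := by positivity
  set P : ℝ := 2 ^ s.card with hP
  have hPpos : 0 < P := by positivity
  have key : P * (1 / 60 * (scaledSum 24 60 60 params₁ / D) + 1 / 20 * (scaledSum 24 20 40 params₂ / D) +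
      1 / 4 * (scaledSum 24 4 16 params₃ / D) + scaledSum 24 1 8 params₄ / D) ≤ P * 0.929 := by
    gcongr
    rw [← sub_nonneg]
    have : 0.929 - (1 / 60 * ((scaledSum 24 60 60 params₁ : ℝ) / D) +
        1 / 20 * (scaledSum 24 20 40 params₂ / D) + 1 / 4 * (scaledSum 24 4 16 params₃ / D) +
        scaledSum 24 1 8 params₄ / D) = (60 * 929 * D - 1000 * ((scaledSum 24 60 60 params₁ : ℝ) +
        3 * scaledSum 24 20 40 params₂ + 15 * scaledSum 24 4 16 params₃ +
        60 * scaledSum 24 1 8 params₄)) / (60000 * D) := by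
      field_simp
      ring
    rw [this]
    exact div_nonneg (by linarith) (by positivity)
  push_cast at *
  linarith

theorem div_add_le_div_add {h H c T : ℝ} (hh : 0 ≤ h) (hH : 0 ≤ H) (hc : 0 ≤ c) (hT : 0 ≤ T) :
    (h + H) / (c + 1 + T) ≤ h + H / (1 + T) := by
  rw [add_div]
  refine add_le_add (div_le_self hh (by linarith)) ?_
  gcongr
  linarith

theorem maxRatio_insert_insert_le {v : ι → ℝ} {s A : Finset ι} {i : ι} (hi : i ∉ s)
    (hA : A ⊆ s) {h c : ℝ} (hh : 0 ≤ h) (hc : 0 < c) :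
    maxRatio v (insert i s) (insert i A) h c ≤ maxRatio v s A (h + 1) c := by
  refine ciSup_le fun r => ?_
  rw [insert_sdiff_insert_of_notMem hi]
  by_cases hri : r ≤ v i
  · rw [card_filter_insert_of_le (fun h => hi (hA h)) hri]
    refine le_trans (le_of_eq ?_) (ratio_le_maxRatio v hA (by linarith) hc r)
    push_cast
    ring
  · push Not at hri
    refine le_trans ?_ (ratio_le_maxRatio v hA (by linarith) hc r)
    rw [Finset.filter_insert, if_neg (not_le.2 hri)]
    gcongr
    linarith

/-- A tail on the largest magnitude raises the denominator to at least c + 1 at every nonempty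
level. From there the head start contributes at most h ≤ h / c and the remaining coins a ratio with
offset 1; levels above the largest magnitude give h / c itself. -/
theorem maxRatio_insert_le {v : ι → ℝ} {s A : Finset ι} {i : ι} (hi : i ∉ s)
    (hmax : ∀ x ∈ s, v x ≤ v i) (hA : A ⊆ s) {h c : ℝ} (hh : 0 ≤ h) (hc : 0 < c) (hc1 : c ≤ 1) :
    maxRatio v (insert i s) A h c ≤ h / c + maxRatio v s A 0 1 := by
  have hhc : h ≤ h / c := le_div_self hh hc hc1
  refine ciSup_le fun r => ?_
  rw [insert_sdiff_of_subset hi hA]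
  by_cases hri : r ≤ v i
  · rw [card_filter_insert_of_le (by simp [hi]) hri]
    push_cast
    rw [add_comm ((((s \ A).filter fun i => r ≤ v i).card : ℝ)) 1, ← add_assoc]
    refine (div_add_le_div_add hh (by positivity) hc.le (by positivity)).trans ?_
    refine add_le_add hhc ?_
    have := ratio_le_maxRatio v hA le_rfl one_pos r
    rwa [zero_add] at this
  · push Not at hri
    rw [Finset.filter_insert, if_neg (not_le.2 hri), filter_le_eq_empty hmax hri hA,
      filter_le_eq_empty hmax hri Finset.sdiff_subset]
    have := maxRatio_nonneg v hA (le_refl (0 : ℝ)) one_pos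
    simpa using this

/-- The expected largest ratio with the denominator offset `c` is at most `1 / c + 1.93`. -/
theorem sum_maxRatio_le_inv_add {c : ℝ} (hc : 0 < c) (hc1 : c ≤ 1) (v : ι → ℝ) (s : Finset ι) :
    ∀ h : ℝ, 0 ≤ h →
    ∑ A ∈ s.powerset, maxRatio v s A h c ≤ 2 ^ s.card * (h / c + (1 / c + 1.93)) := by
  induction hm : s.card generalizing s with
  | zero =>
    intro h hh
    rw [Finset.card_eq_zero] at hm
    subst hm
    have : maxRatio v ∅ ∅ h c ≤ h / c := ciSup_le fun r => by simp
    have h1 : 0 < 1 / c := by positivity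
    simp only [Finset.powerset_empty, Finset.sum_singleton, pow_zero, one_mul]
    linarith
  | succ m ih =>
    intro h hh
    obtain ⟨i, s', hi, rfl, hmax⟩ := exists_eq_insert_max v
      (Finset.card_pos.1 (by rw [hm]; exact m.succ_pos) : s.Nonempty)
    rw [Finset.card_insert_of_notMem hi] at hm
    have hm' : s'.card = m := by omega
    rw [Finset.sum_powerset_insert hi]
    have h1 : ∑ A ∈ s'.powerset, maxRatio v (insert i s') A h c ≤ 2 ^ m * (h / c + 1.93) := by
      refine (Finset.sum_le_sum fun A hA =>
        maxRatio_insert_le hi hmax (Finset.mem_powerset.1 hA) hh hc hc1).trans ?_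
      rw [Finset.sum_add_distrib]
      have := sum_maxRatio_le v s'
      simp only [Finset.sum_const, Finset.card_powerset, nsmul_eq_mul]
      rw [hm'] at this ⊢
      push_cast
      linarith
    have h2 : ∑ A ∈ s'.powerset, maxRatio v (insert i s') (insert i A) h c ≤
        2 ^ m * ((h + 1) / c + (1 / c + 1.93)) :=
      (Finset.sum_le_sum fun A hA =>
        maxRatio_insert_insert_le hi (Finset.mem_powerset.1 hA) hh hc).trans
        (ih s' hm' (h + 1) (by linarith))
    -- The average of h / c + 1.93 (tail) and (h + 1) / c + 1 / c + 1.93 (head) is again h / c + 1 /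
    -- c + 1.93; this fixes the constant.
    refine (add_le_add h1 h2).trans (le_of_eq ?_)
    rw [pow_succ]
    ring

theorem sum_maxRatio_le_of_mem {a c : ℝ}
    (hac : (a, c) ∈ ({(1, 1.93), (0.01, 102)} : Set (ℝ × ℝ))) (v : ι → ℝ) (s : Finset ι) :
    ∑ A ∈ s.powerset, maxRatio v s A 0 a ≤ 2 ^ s.card * c := by
  simp only [Set.mem_insert_iff, Set.mem_singleton_iff, Prod.mk.injEq] at hac
  rcases hac with ⟨rfl, rfl⟩ | ⟨rfl, rfl⟩
  · exact sum_maxRatio_le v s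
  · refine (sum_maxRatio_le_inv_add (by norm_num) (by norm_num) v s 0 le_rfl).trans ?_
    gcongr
    norm_num

end SignWalk

/-! ### Sign symmetry and the expected largest ratio of null statistics -/

section NullRatio

open scoped ENNReal

variable {p : ℕ}

/-- Switch the signs of the entries indexed by `H`. -/
def flipSigns (H : Finset (Fin p)) (w : Fin p → ℝ) : Fin p → ℝ :=
  fun j => if j ∈ H then - w j else w j

/-- The ratio of the numbers of positive and of negative statistics in `N` at the threshold
`|w j|`. -/
def ratioAt (N : Finset (Fin p)) (a : ℝ) (w : Fin p → ℝ) (j : Fin p) : ℝ :=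
  if w j = 0 then 0 else
    ((N.filter fun k => |w j| ≤ w k).card : ℝ) / (a + (N.filter fun k => w k ≤ -|w j|).card)

/-- The largest ratio of the numbers of positive and of negative statistics in `N`. -/
def nullRatio (N : Finset (Fin p)) (a : ℝ) (w : Fin p → ℝ) : ℝ≥0∞ :=
  ⨆ j, ENNReal.ofReal (ratioAt N a w j)

theorem measurable_card_filter {α : Type*} [MeasurableSpace α] (N : Finset (Fin p))
    {P : Fin p → α → Prop} [∀ k x, Decidable (P k x)] (hP : ∀ k, MeasurableSet {x | P k x}) :
    Measurable fun x => ((N.filter fun k => P k x).card : ℝ) := by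
  have : (fun x => ((N.filter fun k => P k x).card : ℝ)) =
      fun x => ∑ k ∈ N, if P k x then (1 : ℝ) else 0 := by
    ext x; simp
  rw [this]
  exact Finset.measurable_sum _ fun k _ =>
    Measurable.ite (hP k) measurable_const measurable_const

theorem measurable_nullRatio (N : Finset (Fin p)) (a : ℝ) : Measurable (nullRatio N a) := by
  refine Measurable.iSup fun j => Measurable.ennreal_ofReal ?_
  refine Measurable.ite (measurableSet_eq_fun (by fun_prop) (by fun_prop)) measurable_const ?_
  refine Measurable.div (measurable_card_filter N fun k => ?_)
    (measurable_const.add (measurable_card_filter N fun k => ?_))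
  · exact measurableSet_le (by fun_prop) (by fun_prop)
  · exact measurableSet_le (by fun_prop) (by fun_prop)

theorem measurable_flipSigns (H : Finset (Fin p)) : Measurable (flipSigns H) := by
  refine measurable_pi_lambda _ fun j => ?_
  unfold flipSigns
  split_ifs <;> fun_prop

/-- Flipping keeps magnitudes and turns the set of positive signs into its symmetric difference with
`H`. Zero statistics may be put on either side, since they lie below every threshold that counts. -/
theorem nullRatio_flipSigns_le {a : ℝ} (ha : 0 < a) {N H : Finset (Fin p)} (hH : H ⊆ N)
    (w : Fin p → ℝ) :
    nullRatio N a (flipSigns H w) ≤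
      ENNReal.ofReal (maxRatio (fun j => |w j|) N (symmDiff (N.filter fun j => 0 < w j) H) 0 a) := by
  refine iSup_le fun j => ENNReal.ofReal_le_ofReal ?_
  have hsub : symmDiff (N.filter fun j => 0 < w j) H ⊆ N := by
    intro x hx
    rcases Finset.mem_symmDiff.1 hx with h | h
    · exact (Finset.mem_filter.1 h.1).1
    · exact hH h.1
  unfold ratioAt
  split_ifs with hj
  · exact maxRatio_nonneg _ hsub le_rfl ha
  have habs : |flipSigns H w j| = |w j| := by
    unfold flipSigns; split_ifs <;> simp
  have hpos : 0 < |w j| := by rw [← habs]; exact abs_pos.2 hj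
  have key := ratio_le_maxRatio (fun j => |w j|) hsub le_rfl ha |w j|
  rw [zero_add] at key
  have h1 : (N.filter fun k => |flipSigns H w j| ≤ flipSigns H w k) =
      ((symmDiff (N.filter fun j => 0 < w j) H).filter fun k => |w j| ≤ |w k|) := by
    ext k
    rw [habs]
    simp only [Finset.mem_filter, Finset.mem_symmDiff]
    rw [flipSigns]
    constructor
    · rintro ⟨hk, hle⟩
      split_ifs at hle with hkH
      · have : ¬ 0 < w k := by linarith
        exact ⟨Or.inr ⟨hkH, by tauto⟩, by rw [abs_of_neg (by linarith : w k < 0)]; exact hle⟩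
      · have : 0 < w k := by linarith
        exact ⟨Or.inl ⟨⟨hk, this⟩, hkH⟩, by rw [abs_of_pos this]; exact hle⟩
    · rintro ⟨h, hle⟩
      rcases h with ⟨⟨hk, hwk⟩, hkH⟩ | ⟨hkH, hn⟩
      · rw [if_neg hkH]
        exact ⟨hk, by rwa [abs_of_pos hwk] at hle⟩
      · rw [if_pos hkH]
        have : ¬ 0 < w k := fun h => hn ⟨hH hkH, h⟩
        exact ⟨hH hkH, by rwa [abs_of_nonpos (not_lt.1 this)] at hle⟩
  have h2 : (N.filter fun k => flipSigns H w k ≤ -|flipSigns H w j|) =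
      ((N \ symmDiff (N.filter fun j => 0 < w j) H).filter fun k => |w j| ≤ |w k|) := by
    ext k
    rw [habs]
    simp only [Finset.mem_filter, Finset.mem_symmDiff, Finset.mem_sdiff]
    rw [flipSigns]
    constructor
    · rintro ⟨hk, hle⟩
      split_ifs at hle with hkH
      · have : 0 < w k := by linarith
        exact ⟨⟨hk, by tauto⟩, by rw [abs_of_pos this]; linarith⟩
      · have : ¬ 0 < w k := by linarith
        exact ⟨⟨hk, by tauto⟩, by rw [abs_of_nonpos (not_lt.1 this)]; linarith⟩
    · rintro ⟨⟨hk, h⟩, hle⟩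
      refine ⟨hk, ?_⟩
      split_ifs with hkH
      · have : 0 < w k := by tauto
        rw [abs_of_pos this] at hle
        linarith
      · have : ¬ 0 < w k := by tauto
        rw [abs_of_nonpos (not_lt.1 this)] at hle
        linarith
  rw [h1, h2]
  exact key

/-- Symmetric difference with the set of positive signs is an involution of the subsets of `N`, so
summing over all flips is summing over all sign patterns. -/
theorem sum_nullRatio_flipSigns_le {a c : ℝ}
    (hac : (a, c) ∈ ({(1, 1.93), (0.01, 102)} : Set (ℝ × ℝ))) (ha : 0 < a) (N : Finset (Fin p))
    (w : Fin p → ℝ) :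
    ∑ H ∈ N.powerset, nullRatio N a (flipSigns H w) ≤ 2 ^ N.card * ENNReal.ofReal c := by
  have hsub : ∀ H ∈ N.powerset, symmDiff (N.filter fun j => 0 < w j) H ∈ N.powerset := by
    intro H hH
    rw [Finset.mem_powerset] at hH ⊢
    intro x hx
    rcases Finset.mem_symmDiff.1 hx with h | h
    · exact (Finset.mem_filter.1 h.1).1
    · exact hH h.1
  calc ∑ H ∈ N.powerset, nullRatio N a (flipSigns H w)
      ≤ ∑ H ∈ N.powerset, ENNReal.ofReal
          (maxRatio (fun j => |w j|) N (symmDiff (N.filter fun j => 0 < w j) H) 0 a) :=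
        Finset.sum_le_sum fun H hH => nullRatio_flipSigns_le ha (Finset.mem_powerset.1 hH) w
    _ = ∑ A ∈ N.powerset, ENNReal.ofReal (maxRatio (fun j => |w j|) N A 0 a) :=
        Finset.sum_nbij' (fun H => symmDiff (N.filter fun j => 0 < w j) H)
          (fun H => symmDiff (N.filter fun j => 0 < w j) H) hsub hsub (by simp) (by simp) (by simp)
    _ = ENNReal.ofReal (∑ A ∈ N.powerset, maxRatio (fun j => |w j|) N A 0 a) :=
        (ENNReal.ofReal_sum_of_nonneg fun A hA =>
          maxRatio_nonneg _ (Finset.mem_powerset.1 hA) le_rfl ha).symm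
    _ ≤ ENNReal.ofReal (2 ^ N.card * c) :=
        ENNReal.ofReal_le_ofReal (sum_maxRatio_le_of_mem hac _ N)
    _ = 2 ^ N.card * ENNReal.ofReal c := by
        rw [ENNReal.ofReal_mul (by positivity), ENNReal.ofReal_pow (by norm_num)]
        simp

/-- The statistics indexed by `N` have exchangeable signs. -/
def SignSymmetric {S : Type*} [MeasurableSpace S] (P : Measure S) (N : Finset (Fin p))
    (w : S → Fin p → ℝ) : Prop :=
  ∀ H ⊆ N, ∀ φ : (Fin p → ℝ) → ℝ≥0∞, Measurable φ →
    ∫⁻ ω, φ (w ω) ∂P = ∫⁻ ω, φ (flipSigns H (w ω)) ∂P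

/-- By symmetry the expectation equals its average over all flips of `N`, and that average is
bounded pointwise by the coin-tossing estimate. -/
theorem SignSymmetric.lintegral_nullRatio_le {S : Type*} [MeasurableSpace S] {P : Measure S}
    [IsProbabilityMeasure P] {N : Finset (Fin p)} {w : S → Fin p → ℝ} (hs : SignSymmetric P N w)
    (hw : AEMeasurable w P) {a c : ℝ}
    (hac : (a, c) ∈ ({(1, 1.93), (0.01, 102)} : Set (ℝ × ℝ))) (ha : 0 < a) :
    ∫⁻ ω, nullRatio N a (w ω) ∂P ≤ ENNReal.ofReal c := by
  have h1 : ∑ H ∈ N.powerset, ∫⁻ ω, nullRatio N a (flipSigns H (w ω)) ∂P =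
      2 ^ N.card * ∫⁻ ω, nullRatio N a (w ω) ∂P := by
    rw [Finset.sum_congr rfl fun H hH =>
      (hs H (Finset.mem_powerset.1 hH) _ (measurable_nullRatio N a)).symm]
    simp
  have h2 : ∑ H ∈ N.powerset, ∫⁻ ω, nullRatio N a (flipSigns H (w ω)) ∂P ≤
      2 ^ N.card * ENNReal.ofReal c := by
    have hmeas : ∀ H ∈ N.powerset, AEMeasurable (fun ω => nullRatio N a (flipSigns H (w ω))) P :=
      fun H _ => ((measurable_nullRatio N a).comp (measurable_flipSigns H)).comp_aemeasurable hw
    rw [← lintegral_finsetSum' _ hmeas]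
    refine (lintegral_mono fun ω => sum_nullRatio_flipSigns_le hac ha N (w ω)).trans ?_
    simp
  rw [h1] at h2
  exact (ENNReal.mul_le_mul_iff_right (by simp) (by simp)).1 h2

end NullRatio

/-! ### False discovery proportion of feasible thresholds -/

section Deterministic

open scoped ENNReal

variable {p : ℕ}

open Classical in
/-- The indices `j ≠ i` that are not adjacent to `i`. -/
def nullSet (G : SimpleGraph (Fin p)) (i : Fin p) : Finset (Fin p) :=
  Finset.univ.filter fun j => j ≠ i ∧ ¬ G.Adj i j

theorem Vplus_top (w : Fin p → ℝ) : Vplus w ⊤ = ∅ := by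
  ext j; simp [Vplus]

-- A finite candidate is |w j| for some nonzero w j, so `nullRatio` sees it; the threshold ⊤ selects
-- nothing. Replacing the null part of V⁻ by all of V⁻ only weakens the bound.
open Classical in
theorem card_Vplus_le {w : Fin p → ℝ} {t : EReal} (ht : t ∈ candidates w) (N : Finset (Fin p))
    {a : ℝ} (ha : 0 < a) :
    ENNReal.ofReal ((N.filter fun j => j ∈ Vplus w t).card : ℝ) ≤
      ENNReal.ofReal (a + ((Vminus w t).ncard : ℝ)) * nullRatio N a w := by
  obtain ⟨h | h, h0⟩ := ht
  · obtain ⟨j, rfl⟩ := h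
    have hj : w j ≠ 0 := by
      simpa only [Set.mem_singleton_iff, EReal.coe_eq_zero, abs_eq_zero] using h0
    refine le_trans ?_ (mul_le_mul_right (le_iSup _ j) _)
    rw [← ENNReal.ofReal_mul (by positivity)]
    refine ENNReal.ofReal_le_ofReal ?_
    simp only [ratioAt, if_neg hj]
    have h1 : (N.filter fun k => k ∈ Vplus w ((|w j| : ℝ) : EReal)) =
        N.filter fun k => |w j| ≤ w k := by
      ext k; simp [Vplus]
    have h2 : ((N.filter fun k => w k ≤ -|w j|).card : ℝ) ≤
        (Vminus w ((|w j| : ℝ) : EReal)).ncard := by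
      rw [← Set.ncard_coe_finset]
      refine Nat.cast_le.2 (Set.ncard_le_ncard (fun k hk => ?_) (Set.toFinite _))
      rw [Finset.mem_coe, Finset.mem_filter] at hk
      change (w k : EReal) ≤ -((|w j| : ℝ) : EReal)
      rw [← EReal.coe_neg, EReal.coe_le_coe_iff]
      exact hk.2
    rw [h1, mul_div_assoc', le_div_iff₀ (by positivity), mul_comm]
    gcongr
  · rw [Set.mem_singleton_iff.1 h]
    simp [Vplus_top]

/-- The number of false edges counted per node: a factor two for the AND rule. -/
def EdgeRule.multiplicity : EdgeRule → ℝ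
  | .and => 2
  | .or => 1

-- Under AND a false edge contributes at both of its endpoints, so the degree sum counts it twice;
-- under OR at least one endpoint contributes.
open Classical in
theorem multiplicity_mul_ncard_le (R : EdgeRule) (G : SimpleGraph (Fin p))
    (V : Fin p → Set (Fin p)) :
    R.multiplicity * (((R.graph V).edgeSet \ G.edgeSet).ncard : ℝ) ≤
      ∑ i, (((nullSet G i).filter fun j => j ∈ V i).card : ℝ) := by
  rw [← SimpleGraph.edgeSet_sdiff]
  cases R with
  | and =>
    set F := EdgeRule.and.graph V \ G with hF
    have h := F.sum_degrees_eq_twice_card_edges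
    have h1 : ((2 : ℕ) : ℝ) * (F.edgeSet.ncard : ℝ) = ∑ i, (F.degree i : ℝ) := by
      rw [← SimpleGraph.coe_edgeFinset, Set.ncard_coe_finset]
      norm_cast
      rw [h]
      congr!
    simp only [EdgeRule.multiplicity]
    rw [show (2 : ℝ) = ((2 : ℕ) : ℝ) by norm_num, h1]
    refine Finset.sum_le_sum fun i _ => ?_
    rw [← SimpleGraph.card_neighborFinset_eq_degree]
    exact_mod_cast Finset.card_le_card fun j hj => by
      rw [SimpleGraph.mem_neighborFinset] at hj
      obtain ⟨⟨hne, h1, h2⟩, h3⟩ := hj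
      simp only [nullSet, Finset.mem_filter, Finset.mem_univ, true_and]
      exact ⟨⟨hne.symm, h3⟩, h2⟩
  | or =>
    simp only [EdgeRule.multiplicity, one_mul]
    rw [← Nat.cast_sum, ← Finset.card_sigma]
    norm_cast
    have : (EdgeRule.or.graph V \ G).edgeSet ⊆
        (((Finset.univ.sigma fun i => (nullSet G i).filter fun j => j ∈ V i).image
          fun x => s(x.1, x.2) : Finset (Sym2 (Fin p))) : Set (Sym2 (Fin p))) := by
      intro e
      induction e with
      | h i j =>
        rintro ⟨⟨hne, h⟩, h3⟩
        simp only [Finset.coe_image, Set.mem_image, Finset.mem_coe, Finset.mem_sigma,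
          Finset.mem_univ, true_and, nullSet, Finset.mem_filter]
        rcases h with h | h
        · exact ⟨⟨j, i⟩, ⟨⟨hne, fun h => h3 h.symm⟩, h⟩, Sym2.eq_swap⟩
        · exact ⟨⟨i, j⟩, ⟨⟨hne.symm, h3⟩, h⟩, rfl⟩
    refine (Set.ncard_le_ncard this (Set.toFinite _)).trans ?_
    rw [Set.ncard_coe_finset]
    exact Finset.card_image_le

theorem fdp_nonneg (G Ghat : SimpleGraph (Fin p)) : 0 ≤ fdp G Ghat := by
  unfold fdp; positivity

theorem fdp_le_one (G Ghat : SimpleGraph (Fin p)) : fdp G Ghat ≤ 1 := by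
  unfold fdp numEdges
  refine div_le_one_of_le₀ (le_trans ?_ (le_max_left _ _)) (by positivity)
  exact_mod_cast Set.ncard_le_ncard Set.sdiff_subset (Set.toFinite _)

theorem fdp_top (R : EdgeRule) (G : SimpleGraph (Fin p)) (W : Fin p → Fin p → ℝ) :
    fdp G (estimatedGraph R W fun _ => ⊤) = 0 := by
  have : (estimatedGraph R W fun _ => ⊤) = ⊥ := by
    ext i j
    simp only [estimatedGraph, Vplus_top]
    cases R <;> simp [EdgeRule.graph]
  simp [fdp, this]

/-- The random number of edges cancels: feasibility at every node bounds a + |V_i⁻| by the level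
times the same denominator as in the false discovery proportion. -/
theorem fdp_le_of_feasible {R : EdgeRule} {q a c : ℝ} (ha : 0 < a) {W : Fin p → Fin p → ℝ}
    {T : Fin p → EReal} (hT : Feasible R q a c W T) (G : SimpleGraph (Fin p)) :
    ENNReal.ofReal (fdp G (estimatedGraph R W T)) ≤
      ENNReal.ofReal (R.level p q c / R.multiplicity) *
        ∑ i, nullRatio (nullSet G i) a (W i) := by
  classical
  have hm : 0 < R.multiplicity := by cases R <;> simp [EdgeRule.multiplicity]
  set E : ℝ := max (numEdges (estimatedGraph R W T) : ℝ) 1 with hE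
  have hEpos : 0 < E := lt_of_lt_of_le one_pos (le_max_right _ _)
  have h1 : fdp G (estimatedGraph R W T) ≤ (1 / (R.multiplicity * E)) *
      ∑ i, (((nullSet G i).filter fun j => j ∈ Vplus (W i) (T i)).card : ℝ) := by
    have := multiplicity_mul_ncard_le R G fun i => Vplus (W i) (T i)
    rw [fdp, ← hE, one_div, inv_mul_eq_div, div_le_div_iff₀ hEpos (by positivity)]
    unfold estimatedGraph
    nlinarith
  refine (ENNReal.ofReal_le_ofReal h1).trans ?_
  rw [ENNReal.ofReal_mul (by positivity), ENNReal.ofReal_sum_of_nonneg fun _ _ => by positivity,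
    Finset.mul_sum, Finset.mul_sum]
  refine Finset.sum_le_sum fun i _ => ?_
  refine (mul_le_mul_right (card_Vplus_le (hT i).1 (nullSet G i) ha) _).trans ?_
  rw [← mul_assoc, ← ENNReal.ofReal_mul (by positivity)]
  refine mul_le_mul_left (ENNReal.ofReal_le_ofReal ?_) _
  have h2 := (hT i).2
  rw [← hE] at h2
  calc 1 / (R.multiplicity * E) * (a + ((Vminus (W i) (T i)).ncard : ℝ))
      = (a + ((Vminus (W i) (T i)).ncard : ℝ)) / E / R.multiplicity := by
        field_simp
    _ ≤ _ := by gcongr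

end Deterministic

/-! ### Measurability of the thresholds and of the estimated graph -/

section Measurability

variable {p : ℕ}

/-- Finitely many events take values in a finite discrete space, so `f` may be arbitrary. Edge sets
and counts depend on the statistics only through finitely many comparisons. -/
theorem measurable_of_predicates {α β κ : Type*} [Finite κ] [MeasurableSpace α]
    [MeasurableSpace β] {P : κ → α → Prop} (hP : ∀ i, MeasurableSet {x | P i x})
    (f : (κ → Prop) → β) : Measurable fun x => f fun i => P i x :=
  (Measurable.of_discrete (f := f)).comp <| measurable_pi_lambda _ fun i =>
    measurable_to_prop (by simpa [Set.preimage] using hP i)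

theorem measurableSet_le_coe {α : Type*} [MeasurableSpace α] {W : α → ℝ} {T : α → EReal}
    (hW : Measurable W) (hT : Measurable T) : MeasurableSet {x | T x ≤ (W x : EReal)} :=
  measurableSet_le hT (measurable_coe_real_ereal.comp hW)

theorem measurable_estimatedGraph {β : Type*} [MeasurableSpace β] (R : EdgeRule)
    (f : SimpleGraph (Fin p) → β) :
    Measurable fun x : (Fin p → Fin p → ℝ) × (Fin p → EReal) => f (estimatedGraph R x.1 x.2) :=
  measurable_of_predicates
    (P := fun (k : Fin p × Fin p) (x : (Fin p → Fin p → ℝ) × (Fin p → EReal)) =>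
      x.2 k.1 ≤ (x.1 k.1 k.2 : EReal))
    (fun k => measurableSet_le_coe (by fun_prop) (by fun_prop))
    fun V => f (R.graph fun i => {j | V (i, j)})

theorem measurable_ncard_Vminus {α : Type*} [MeasurableSpace α] {w : α → Fin p → ℝ}
    {t : α → EReal} (hw : Measurable w) (ht : Measurable t) :
    Measurable fun x => (Vminus (w x) (t x)).ncard :=
  measurable_of_predicates (P := fun j x => (w x j : EReal) ≤ -t x)
    (fun j => measurableSet_le (measurable_coe_real_ereal.comp (by fun_prop)) ht.neg)
    fun V => {j | V j}.ncard

theorem measurableSet_mem_candidates {α : Type*} [MeasurableSpace α] {w : α → Fin p → ℝ}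
    {t : α → EReal} (hw : Measurable w) (ht : Measurable t) :
    MeasurableSet {x | t x ∈ candidates (w x)} := by
  have : {x | t x ∈ candidates (w x)} =
      ((⋃ j, {x | ((|w x j| : ℝ) : EReal) = t x}) ∪ {x | t x = ⊤}) ∩ {x | t x = 0}ᶜ := by
    ext x
    simp [candidates, and_comm, or_comm]
  rw [this]
  refine ((MeasurableSet.iUnion fun j => ?_).union ?_).inter (MeasurableSet.compl ?_)
  · have hj : Measurable fun x => w x j := by fun_prop
    exact measurableSet_eq_fun (measurable_coe_real_ereal.comp hj.abs) ht
  · exact measurableSet_eq_fun ht measurable_const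
  · exact measurableSet_eq_fun ht measurable_const

theorem measurableSet_feasible (R : EdgeRule) (q a c : ℝ)
    {T : (Fin p → Fin p → ℝ) → Fin p → EReal} (hT : Measurable T) :
    MeasurableSet {W | Feasible R q a c W (T W)} := by
  unfold Feasible
  rw [Set.ofPred_forall]
  refine MeasurableSet.iInter fun i => ?_
  rw [Set.ofPred_and]
  refine (measurableSet_mem_candidates (by fun_prop) (by fun_prop)).inter ?_
  refine measurableSet_le (Measurable.div (measurable_const.add ?_)
    (Measurable.max ?_ measurable_const)) measurable_const
  · exact (Measurable.of_discrete (f := ((↑) : ℕ → ℝ))).comp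
      (measurable_ncard_Vminus (by fun_prop) (by fun_prop))
  · have h : Measurable fun W : Fin p → Fin p → ℝ => (W, T W) := measurable_id.prodMk hT
    have h2 := (measurable_estimatedGraph R fun G => (numEdges G : ℝ)).comp h
    simpa only [Function.comp_def] using h2

-- A finite infimum of explicit functions, with ⊤ at the indices that do not qualify, makes
-- measurability visible.
open Classical in
theorem levelThreshold_eq_iInf (W : Fin p → Fin p → ℝ) (m : ℕ) (i : Fin p) :
    levelThreshold W m i = ⨅ j, if |W i j| ≠ 0 ∧ (Vminus (W i) ((|W i j| : ℝ) : EReal)).ncard ≤ m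
      then ((|W i j| : ℝ) : EReal) else ⊤ := by
  unfold levelThreshold
  refine le_antisymm (le_iInf fun j => ?_) (le_sInf ?_)
  · split_ifs with h
    · exact sInf_le ⟨⟨Or.inl ⟨j, rfl⟩, by simpa using h.1⟩, h.2⟩
    · exact le_top
  · rintro t ⟨⟨h | h, h0⟩, hm⟩
    · obtain ⟨j, rfl⟩ := h
      refine (iInf_le _ j).trans ?_
      rw [if_pos ⟨by simpa only [Set.mem_singleton_iff, EReal.coe_eq_zero] using h0, hm⟩]
    · rw [Set.mem_singleton_iff.1 h]; exact le_top

theorem measurable_levelThreshold (m : ℕ) :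
    Measurable fun W : Fin p → Fin p → ℝ => levelThreshold W m := by
  classical
  refine measurable_pi_lambda _ fun i => ?_
  simp only [levelThreshold_eq_iInf]
  refine Measurable.iInf fun j => ?_
  have h1 : Measurable fun W : Fin p → Fin p → ℝ => |W i j| := by
    have : Measurable fun W : Fin p → Fin p → ℝ => W i j := by fun_prop
    exact this.abs
  have h2 := measurable_coe_real_ereal.comp h1
  refine Measurable.ite (MeasurableSet.inter ?_ ?_) h2 measurable_const
  · exact (measurableSet_eq_fun h1 measurable_const).compl
  · exact measurableSet_le (measurable_ncard_Vminus (by fun_prop) h2) measurable_const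

theorem measurable_thresholdAlgorithm (R : EdgeRule) (q a c : ℝ) :
    Measurable fun W : Fin p → Fin p → ℝ => thresholdAlgorithm R q a c W := by
  classical
  unfold thresholdAlgorithm
  generalize (List.range (R.mMax p q a c + 1).toNat).reverse = l
  induction l with
  | nil => simp
  | cons m l ih =>
    have h := @Measurable.ite _ _ _ _ _ _
      (fun W : Fin p → Fin p → ℝ => Feasible R q a c W (levelThreshold W m))
      (fun _ => Classical.propDecidable _)
      (measurableSet_feasible R q a c (measurable_levelThreshold m)) (measurable_levelThreshold m) ih
    refine (congrArg Measurable (funext fun W => ?_)).mpr h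
    by_cases hm : Feasible R q a c W (levelThreshold W m) <;> simp [hm]

/-- This is all that the error bound needs about the algorithm; neither the order of the search nor
the choice of its first value of m enters. -/
theorem thresholdAlgorithm_feasible_or (R : EdgeRule) (q a c : ℝ) (W : Fin p → Fin p → ℝ) :
    Feasible R q a c W (thresholdAlgorithm R q a c W) ∨
      thresholdAlgorithm R q a c W = fun _ => ⊤ := by
  classical
  unfold thresholdAlgorithm
  split
  · next m h => exact Or.inl (by simpa using List.find?_some h)
  · exact Or.inr rfl

end Measurability

/-! ### False discovery rate under sign symmetry -/

section FDR

open scoped ENNReal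

variable {p : ℕ}

/-- The bound in terms of `nullRatio` is linear in the nodes, so only the marginal sign symmetry of
each node is needed, not the joint law of the nodes. -/
theorem integral_fdp_le {S : Type*} [MeasurableSpace S] {P : Measure S} [IsProbabilityMeasure P]
    {q a c : ℝ} (hq : 0 ≤ q) (hac : (a, c) ∈ ({(1, 1.93), (0.01, 102)} : Set (ℝ × ℝ)))
    (R : EdgeRule) (G : SimpleGraph (Fin p)) {W : S → Fin p → Fin p → ℝ} (hW : AEMeasurable W P)
    (hsym : ∀ i, SignSymmetric P (nullSet G i) fun ω => W ω i) {T : S → Fin p → EReal}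
    (hTm : AEMeasurable T P) (hT : ∀ᵐ ω ∂P, Feasible R q a c (W ω) (T ω) ∨ T ω = fun _ => ⊤) :
    Integrable (fun ω => fdp G (estimatedGraph R (W ω) (T ω))) P ∧
      ∫ ω, fdp G (estimatedGraph R (W ω) (T ω)) ∂P ≤ q := by
  have hac' : 0 < a ∧ 0 < c := by
    simp only [Set.mem_insert_iff, Set.mem_singleton_iff, Prod.mk.injEq] at hac
    rcases hac with ⟨rfl, rfl⟩ | ⟨rfl, rfl⟩ <;> norm_num
  obtain ⟨ha, hc⟩ := hac'
  have hmeas : AEMeasurable (fun ω => fdp G (estimatedGraph R (W ω) (T ω))) P := by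
    have h := (measurable_estimatedGraph R (fdp G)).comp_aemeasurable (hW.prodMk hTm)
    simpa only [Function.comp_def] using h
  have hint : Integrable (fun ω => fdp G (estimatedGraph R (W ω) (T ω))) P := by
    refine Integrable.of_bound hmeas.aestronglyMeasurable 1 (ae_of_all _ fun ω => ?_)
    rw [Real.norm_of_nonneg (fdp_nonneg _ _)]
    exact fdp_le_one _ _
  refine ⟨hint, ?_⟩
  rw [integral_eq_lintegral_of_nonneg_ae (ae_of_all _ fun _ => fdp_nonneg _ _)
    hmeas.aestronglyMeasurable]
  refine ENNReal.toReal_le_of_le_ofReal hq ?_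
  have hWi : ∀ i, AEMeasurable (fun ω => W ω i) P := fun i =>
    (measurable_pi_apply i).comp_aemeasurable hW
  have hl : 0 ≤ R.level p q c / R.multiplicity := by
    cases R <;> simp only [EdgeRule.level, EdgeRule.multiplicity] <;> positivity
  calc ∫⁻ ω, ENNReal.ofReal (fdp G (estimatedGraph R (W ω) (T ω))) ∂P
      ≤ ∫⁻ ω, ENNReal.ofReal (R.level p q c / R.multiplicity) *
          ∑ i, nullRatio (nullSet G i) a (W ω i) ∂P := by
        refine lintegral_mono_ae (hT.mono fun ω hω => ?_)
        rcases hω with h | h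
        · exact fdp_le_of_feasible ha h G
        · simp [h, fdp_top]
    _ = ENNReal.ofReal (R.level p q c / R.multiplicity) *
          ∑ i, ∫⁻ ω, nullRatio (nullSet G i) a (W ω i) ∂P := by
        have hm : ∀ i ∈ (Finset.univ : Finset (Fin p)),
            AEMeasurable (fun ω => nullRatio (nullSet G i) a (W ω i)) P :=
          fun i _ => (measurable_nullRatio _ a).comp_aemeasurable (hWi i)
        rw [lintegral_const_mul' _ _ ENNReal.ofReal_ne_top, lintegral_finsetSum' _ hm]
    _ ≤ ENNReal.ofReal (R.level p q c / R.multiplicity) * ∑ _i : Fin p, ENNReal.ofReal c := by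
        gcongr with i
        exact (hsym i).lintegral_nullRatio_le (hWi i) hac ha
    _ = ENNReal.ofReal (R.level p q c / R.multiplicity * (p * c)) := by
        rw [Finset.sum_const, Finset.card_univ, Fintype.card_fin, nsmul_eq_mul,
          ENNReal.ofReal_mul hl, ENNReal.ofReal_mul (by positivity), ENNReal.ofReal_natCast]
    _ ≤ ENNReal.ofReal q := by
        refine ENNReal.ofReal_le_ofReal ?_
        -- For `p = 0` the left side is zero; otherwise `p`, `c` and the multiplicity cancel against
        -- the level, leaving exactly `q`.
        rcases Nat.eq_zero_or_pos p with rfl | hp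
        · simpa using hq
        · have : (0 : ℝ) < p := by exact_mod_cast hp
          cases R <;> simp only [EdgeRule.level, EdgeRule.multiplicity] <;> apply le_of_eq <;>
            field_simp

end FDR

/-! ### Knockoff matrices -/

section Knockoff

variable {n ι : Type*} [Fintype n] [Fintype ι] [DecidableEq ι]

theorem Strategy.Chooses.nonneg {O : Strategy} {X : Matrix n ι ℝ} {s : ι → ℝ}
    (h : O.Chooses X s) (j : ι) : 0 ≤ s j := by
  cases O with
  | equi =>
    have hs : s j = _ := h j
    rw [hs]
    refine le_min (mul_nonneg zero_le_two (Real.sInf_nonneg fun x hx => ?_)) zero_le_one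
    have hpos : (Xᵀ * X).PosSemidef := by
      simpa using Matrix.posSemidef_conjTranspose_mul_self X
    exact (Matrix.posSemidef_iff_isHermitian_and_spectrum_nonneg.1 hpos).2 hx
  | sdp => exact (h.1.2 j).1

omit [Fintype ι] [DecidableEq ι] in
theorem pairGram_eq_fromBlocks (X Xt : Matrix n ι ℝ) :
    pairGram X Xt = fromBlocks (Xᵀ * X) (Xᵀ * Xt) (Xtᵀ * X) (Xtᵀ * Xt) := by
  rw [pairGram, transpose_fromCols, fromRows_mul_fromCols]

/-- Since U is orthogonal to X, the cross products see only the first summand; the choice of CᵀC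
restores what is missing in X̃ᵀX̃. -/
theorem IsKnockoffConstruction.isKnockoff {O : Strategy} {K : Matrix n ι ℝ → Matrix n ι ℝ}
    (hK : IsKnockoffConstruction O K) {X : Matrix n ι ℝ} (hX : IsUnit (Xᵀ * X).det) :
    IsKnockoff X (K X) := by
  obtain ⟨s, U, C, hs, hU, hUX, hC, hKX⟩ := hK.2 X hX
  refine ⟨hX, s, hs.nonneg, ?_⟩
  have hXU : Xᵀ * U = 0 := by
    have := congrArg transpose hUX
    simpa using this
  have hsym : (Xᵀ * X)ᵀ = Xᵀ * X := by simp
  have h12 : Xᵀ * K X = Xᵀ * X - diagonal s := by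
    rw [hKX, Matrix.mul_add, ← Matrix.mul_assoc, ← Matrix.mul_assoc, hXU, Matrix.zero_mul, add_zero,
      Matrix.mul_sub, Matrix.mul_one, ← Matrix.mul_assoc, Matrix.mul_nonsing_inv _ hX,
      Matrix.one_mul]
  have h21 : (K X)ᵀ * X = Xᵀ * X - diagonal s := by
    have := congrArg transpose h12
    simpa using this
  have hKU : (K X)ᵀ * U = Cᵀ := by
    rw [hKX, transpose_add, Matrix.add_mul, transpose_mul, transpose_mul, Matrix.mul_assoc, hXU,
      Matrix.mul_zero, zero_add, Matrix.mul_assoc, hU, Matrix.mul_one]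
  have h22 : (K X)ᵀ * K X = Xᵀ * X := by
    nth_rewrite 2 [hKX]
    rw [Matrix.mul_add, ← Matrix.mul_assoc, ← Matrix.mul_assoc, hKU, hC, h21, Matrix.sub_mul,
      Matrix.mul_sub, Matrix.mul_sub, Matrix.mul_one, Matrix.mul_one, ← Matrix.mul_assoc,
      Matrix.mul_nonsing_inv _ hX, Matrix.one_mul, ← Matrix.mul_assoc, two_smul]
    abel
  rw [pairGram_eq_fromBlocks, h12, h21, h22]

omit [Fintype n] [Fintype ι] [DecidableEq ι] in
/-- Exchange of the columns of `X` and of `X̃` indexed by `H`. -/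
theorem fromCols_swapIn_apply (H : Set ι) [DecidablePred (· ∈ H)] (X Xt : Matrix n ι ℝ) (k : n)
    (x : ι ⊕ ι) : fromCols (swapIn H X Xt) (swapIn H Xt X) k x =
      fromCols X Xt k (if x.elim id id ∈ H then x.swap else x) := by
  rcases x with j | j <;> by_cases hj : j ∈ H <;> simp [swapIn, hj]

/-- Off the diagonal all four blocks of the Gram matrix agree. On the diagonal a swap exchanges the
two equal diagonal blocks and the two equal off-diagonal blocks. -/
theorem IsKnockoff.pairGram_swapIn {X Xt : Matrix n ι ℝ} (h : IsKnockoff X Xt) (H : Set ι) :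
    pairGram (swapIn H X Xt) (swapIn H Xt X) = pairGram X Xt := by
  classical
  obtain ⟨-, s, -, hs⟩ := h
  have hgram : ∀ x y, pairGram (swapIn H X Xt) (swapIn H Xt X) x y = pairGram X Xt
      (if x.elim id id ∈ H then x.swap else x) (if y.elim id id ∈ H then y.swap else y) := by
    intro x y
    simp only [pairGram, Matrix.mul_apply, transpose_apply, fromCols_swapIn_apply]
  ext x y
  rw [hgram, hs]
  rcases x with i | i <;> rcases y with j | j <;> by_cases hi : i ∈ H <;> by_cases hj : j ∈ H <;>
    simp only [Sum.elim_inl, Sum.elim_inr, id, hi, hj, if_true, if_false, Sum.swap_inl,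
      Sum.swap_inr, fromBlocks_apply₁₁, fromBlocks_apply₁₂, fromBlocks_apply₂₁,
      fromBlocks_apply₂₂, Matrix.sub_apply] <;>
    -- What is left are the pairs with exactly one index in `H`; these are distinct indices, where
    -- `s` does not enter.
    rw [diagonal_apply_ne _ (fun h : i = j => by subst h; contradiction), sub_zero]

theorem IsKnockoff.gram_swapIn {X Xt : Matrix n ι ℝ} (h : IsKnockoff X Xt) (H : Set ι) :
    (swapIn H X Xt)ᵀ * swapIn H X Xt = Xᵀ * X := by
  have := congrArg toBlocks₁₁ (h.pairGram_swapIn H)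
  simpa only [pairGram_eq_fromBlocks, toBlocks_fromBlocks₁₁] using this

theorem IsKnockoff.swapIn {X Xt : Matrix n ι ℝ} (h : IsKnockoff X Xt) (H : Set ι) :
    IsKnockoff (swapIn H X Xt) (swapIn H Xt X) := by
  refine ⟨by rw [h.gram_swapIn]; exact h.1, ?_⟩
  rw [h.gram_swapIn, h.pairGram_swapIn]
  exact h.2

/-- The mean Xβ is [X X̃] applied to (β, 0), both before and after the swap, because β vanishes on
the swapped columns. Its inner products are then the Gram matrix applied to (β, 0). -/
theorem IsKnockoff.swapIn_mulVec {X Xt : Matrix n ι ℝ} (h : IsKnockoff X Xt) {H : Set ι}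
    {β : ι → ℝ} (hβ : ∀ j ∈ H, β j = 0) :
    (fromCols (GGMKnockoff.swapIn H X Xt) (GGMKnockoff.swapIn H Xt X))ᵀ *ᵥ (X *ᵥ β) =
      (fromCols X Xt)ᵀ *ᵥ (X *ᵥ β) := by
  classical
  have h1 : X *ᵥ β = fromCols X Xt *ᵥ Sum.elim β 0 := by
    rw [fromCols_mulVec]; simp
  have h2 : X *ᵥ β = fromCols (GGMKnockoff.swapIn H X Xt) (GGMKnockoff.swapIn H Xt X) *ᵥ
      Sum.elim β 0 := by
    rw [fromCols_mulVec]
    ext k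
    simp only [mulVec, dotProduct, Pi.add_apply]
    simp only [Function.comp_apply, Sum.elim_inl, Sum.elim_inr, Pi.zero_apply, mul_zero,
      Finset.sum_const_zero, add_zero]
    refine Finset.sum_congr rfl fun j _ => ?_
    by_cases hj : j ∈ H
    · simp [hβ j hj]
    · simp [GGMKnockoff.swapIn, hj]
  have h3 := h.pairGram_swapIn H
  unfold pairGram at h3
  rw [h2, mulVec_mulVec, h3, ← mulVec_mulVec, ← h1, h2]

end Knockoff

/-! ### Linear images of spherical Gaussian noise -/

section Gaussian

variable {n κ : Type*} [Fintype n] [Fintype κ]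

theorem charFunDual_gaussianReal (v : NNReal) (L : StrongDual ℝ ℝ) :
    charFunDual (gaussianReal 0 v) L = Complex.exp (-(v * (L 1 : ℂ) ^ 2 / 2)) := by
  have h : ∀ x, L x = L 1 * x := fun x => by
    conv_lhs => rw [← mul_one x, ← smul_eq_mul, map_smul, smul_eq_mul, mul_comm]
  have h' : ∀ x, Complex.exp ((L x : ℂ) * Complex.I) =
      Complex.exp ((L 1 : ℂ) * x * Complex.I) := fun x => by rw [h x]; push_cast; rfl
  rw [charFunDual_apply, integral_congr_ae (ae_of_all _ h')]
  rw [← charFun_apply_real, charFun_gaussianReal]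
  congr 1
  simp

theorem charFunDual_map_transpose_mulVec (v : NNReal) (A : Matrix n κ ℝ)
    (L : StrongDual ℝ (κ → ℝ)) :
    charFunDual ((Measure.pi fun _ : n => gaussianReal 0 v).map fun e => Aᵀ *ᵥ e) L =
      Complex.exp (-(v * ((∑ k, L (A k) ^ 2 : ℝ) : ℂ) / 2)) := by
  classical
  have hA : (fun e : n → ℝ => Aᵀ *ᵥ e) = (Aᵀ.mulVecLin).toContinuousLinearMap := rfl
  rw [hA, charFunDual_map, charFunDual_pi]
  simp_rw [charFunDual_gaussianReal]
  rw [← Complex.exp_sum]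
  congr 1
  push_cast
  rw [Finset.sum_neg_distrib, ← Finset.sum_div, ← Finset.mul_sum]
  congr 5
  ext k
  congr 3
  simp
  rfl

theorem sum_sq_dual_eq (A : Matrix n κ ℝ) (L : StrongDual ℝ (κ → ℝ)) [DecidableEq κ] :
    ∑ k, L (A k) ^ 2 = (fun x => L (Pi.single x 1)) ⬝ᵥ
      (Aᵀ * A) *ᵥ (fun x => L (Pi.single x 1)) := by
  have h : ∀ k, L (A k) = (A *ᵥ fun x => L (Pi.single x 1)) k := by
    intro k
    conv_lhs => rw [← Finset.univ_sum_single (A k), map_sum]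
    refine Finset.sum_congr rfl fun x _ => ?_
    rw [show (Pi.single x (A k x) : κ → ℝ) = A k x • Pi.single x 1 by
      rw [← Pi.single_smul]; simp, map_smul, smul_eq_mul]
  rw [← mulVec_mulVec, dotProduct_mulVec, vecMul_transpose]
  simp_rw [h, dotProduct, sq]

/-- The law of `Aᵀ e` for a spherical Gaussian vector `e` depends on `Aᵀ A` only. -/
theorem map_transpose_mulVec_eq (v : NNReal) {A B : Matrix n κ ℝ} (h : Aᵀ * A = Bᵀ * B) :
    (Measure.pi fun _ : n => gaussianReal 0 v).map (fun e => Aᵀ *ᵥ e) =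
      (Measure.pi fun _ : n => gaussianReal 0 v).map fun e => Bᵀ *ᵥ e := by
  classical
  have hm : ∀ A : Matrix n κ ℝ, IsProbabilityMeasure
      ((Measure.pi fun _ : n => gaussianReal 0 v).map fun e => Aᵀ *ᵥ e) := fun A => by
    have hA : (fun e : n → ℝ => Aᵀ *ᵥ e) = (Aᵀ.mulVecLin).toContinuousLinearMap := rfl
    rw [hA]
    exact Measure.isProbabilityMeasure_map (by fun_prop)
  have := hm A
  have := hm B
  refine Measure.ext_of_charFunDual (funext fun L => ?_)
  rw [charFunDual_map_transpose_mulVec, charFunDual_map_transpose_mulVec, sum_sq_dual_eq,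
    sum_sq_dual_eq, h]

theorem measurable_transpose_mulVec (A : Matrix n κ ℝ) : Measurable fun e : n → ℝ => Aᵀ *ᵥ e := by
  have hA : (fun e : n → ℝ => Aᵀ *ᵥ e) = (Aᵀ.mulVecLin).toContinuousLinearMap := rfl
  rw [hA]
  fun_prop

end Gaussian

/-! ### Sign flips in a linear model with a fixed design -/

section FixedDesign

open scoped ENNReal

variable {n ι : Type*} [Fintype n] [Fintype ι] [DecidableEq ι]

open Classical in
/-- For a fixed design with a knockoff matrix, a spherical Gaussian noise and coefficients that
vanish on `H`, the statistics are invariant under switching the signs on `H`. -/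
theorem lintegral_flip_statistics {Pr : FeatureProcedure n ι} (hsuff : Pr.Sufficient)
    (hanti : Pr.Antisymmetric) {D Dt : Matrix n ι ℝ} (hD : IsKnockoff D Dt) {H : Set ι} {β : ι → ℝ}
    (hβ : ∀ j ∈ H, β j = 0) (v : NNReal) {φ : (ι → ℝ) → ℝ≥0∞} (hφ : Measurable φ) :
    ∫⁻ e, φ (Pr D Dt (D *ᵥ β + e)) ∂(Measure.pi fun _ : n => gaussianReal 0 v) =
      ∫⁻ e, φ (fun j => if j ∈ H then - Pr D Dt (D *ᵥ β + e) j else Pr D Dt (D *ᵥ β + e) j)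
        ∂(Measure.pi fun _ : n => gaussianReal 0 v) := by
  obtain ⟨f, hf, hW⟩ := hsuff
  set b := (fromCols D Dt)ᵀ *ᵥ (D *ᵥ β) with hb
  set g : (ι ⊕ ι → ℝ) → ℝ≥0∞ := fun z => φ (f (fun x y => pairGram D Dt x y, b + z)) with hg
  have hgm : Measurable g := hφ.comp (hf.comp (by fun_prop))
  have h1 : ∀ e, φ (Pr D Dt (D *ᵥ β + e)) = g ((fromCols D Dt)ᵀ *ᵥ e) := fun e => by
    rw [hW _ _ _ hD, mulVec_add]
  have h2 : ∀ e, φ (fun j => if j ∈ H then - Pr D Dt (D *ᵥ β + e) j else Pr D Dt (D *ᵥ β + e) j) =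
      g ((fromCols (swapIn H D Dt) (swapIn H Dt D))ᵀ *ᵥ e) := fun e => by
    rw [← funext (hanti D Dt (D *ᵥ β + e) hD H), hW _ _ _ (hD.swapIn H), mulVec_add,
      hD.swapIn_mulVec hβ, hD.pairGram_swapIn]
  simp_rw [h1, h2]
  rw [← lintegral_map hgm (measurable_transpose_mulVec _),
    ← lintegral_map hgm (measurable_transpose_mulVec _),
    map_transpose_mulVec_eq v (hD.pairGram_swapIn H).symm]

end FixedDesign

/-! ### Regression of one coordinate of a Gaussian vector on the others -/

section Regression

variable {p : ℕ}

/-- The linear form `x ↦ (Ω x)_i`. -/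
def precisionForm (Ω : Matrix (Fin p) (Fin p) ℝ) (i : Fin p) :
    EuclideanSpace ℝ (Fin p) →L[ℝ] ℝ :=
  ∑ k, Ω i k • EuclideanSpace.proj k

theorem precisionForm_apply (Ω : Matrix (Fin p) (Fin p) ℝ) (i : Fin p)
    (x : EuclideanSpace ℝ (Fin p)) : precisionForm Ω i x = ∑ k, Ω i k * x k := by
  simp [precisionForm]

theorem memLp_eval_multivariateGaussian (S : Matrix (Fin p) (Fin p) ℝ) (k : Fin p) :
    MemLp (fun x : EuclideanSpace ℝ (Fin p) => x k) 2 (multivariateGaussian 0 S) :=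
  (IsGaussian.hasGaussianLaw_id.map_fun (EuclideanSpace.proj k)).memLp_two

theorem memLp_precisionForm (Ω S : Matrix (Fin p) (Fin p) ℝ) (i : Fin p) :
    MemLp (fun x => precisionForm Ω i x) 2 (multivariateGaussian 0 S) :=
  (IsGaussian.hasGaussianLaw_id.map_fun (precisionForm Ω i)).memLp_two

theorem integral_clm_multivariateGaussian (S : Matrix (Fin p) (Fin p) ℝ)
    (L : EuclideanSpace ℝ (Fin p) →L[ℝ] ℝ) : ∫ x, L x ∂(multivariateGaussian 0 S) = 0 := by
  have := L.integral_comp_comm (μ := multivariateGaussian 0 S) (φ := fun x => x)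
    IsGaussian.integrable_fun_id
  simpa using this

/-- The covariance of x with Ωx is Ω⁻¹Ω, the identity. -/
theorem covariance_precisionForm {Ω : Matrix (Fin p) (Fin p) ℝ} (hΩ : Ω.PosDef) (i j : Fin p) :
    cov[fun x => x j, fun x => precisionForm Ω i x; multivariateGaussian 0 Ω⁻¹] =
      if j = i then 1 else 0 := by
  have hS : (Ω⁻¹).PosSemidef := hΩ.inv.posSemidef
  simp_rw [precisionForm_apply]
  rw [covariance_fun_sum_right fun k => (memLp_eval_multivariateGaussian _ k).const_mul _]
  · simp_rw [covariance_const_mul_right, covariance_eval_multivariateGaussian hS]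
    have hsymm : ∀ k, Ω i k = Ω k i := fun k => by
      have := hΩ.isHermitian.apply k i
      simpa using this
    have : ∑ k, Ω i k * Ω⁻¹ j k = (Ω⁻¹ * Ω) j i := by
      rw [Matrix.mul_apply]
      exact Finset.sum_congr rfl fun k _ => by rw [hsymm, mul_comm]
    rw [this, Matrix.nonsing_inv_mul _ ((Matrix.isUnit_iff_isUnit_det _).1 hΩ.isUnit),
      Matrix.one_apply]
  · exact memLp_eval_multivariateGaussian _ j

theorem variance_precisionForm {Ω : Matrix (Fin p) (Fin p) ℝ} (hΩ : Ω.PosDef) (i : Fin p) :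
    Var[fun x => precisionForm Ω i x; multivariateGaussian 0 Ω⁻¹] = Ω i i := by
  rw [← covariance_self (by fun_prop)]
  conv_lhs => enter [1, x]; rw [precisionForm_apply]
  rw [covariance_fun_sum_left fun k => (memLp_eval_multivariateGaussian _ k).const_mul _]
  · simp_rw [covariance_const_mul_left, covariance_precisionForm hΩ]
    simp
  · exact memLp_precisionForm _ _ _

/-- Restriction to the coordinates other than `i`. -/
def restrictNe (i : Fin p) (x : EuclideanSpace ℝ (Fin p)) : {j : Fin p // j ≠ i} → ℝ := fun j => x j

/-- Jointly Gaussian and uncorrelated, hence independent. The `Unit`-indexed family only presents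
the single form as a vector. -/
theorem indepFun_restrictNe_precisionForm {Ω : Matrix (Fin p) (Fin p) ℝ} (hΩ : Ω.PosDef)
    (i : Fin p) : IndepFun (restrictNe i) (fun x => precisionForm Ω i x)
      (multivariateGaussian 0 Ω⁻¹) := by
  let L : EuclideanSpace ℝ (Fin p) →L[ℝ] ({j : Fin p // j ≠ i} → ℝ) × (Unit → ℝ) :=
    ContinuousLinearMap.prod (ContinuousLinearMap.pi fun j => EuclideanSpace.proj j.1)
      (ContinuousLinearMap.pi fun _ => precisionForm Ω i)
  have h := HasGaussianLaw.indepFun_of_covariance_eval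
    (X := fun (j : {j : Fin p // j ≠ i}) (x : EuclideanSpace ℝ (Fin p)) => x j)
    (Y := fun (_ : Unit) x => precisionForm Ω i x) (P := multivariateGaussian 0 Ω⁻¹)
    (IsGaussian.hasGaussianLaw_id.map_fun L) fun j _ => by
      rw [covariance_precisionForm hΩ, if_neg j.2]
  exact h.comp (φ := id) (ψ := fun y : Unit → ℝ => y ()) measurable_id (by fun_prop)

/-- The residual of coordinate `i` after regression on the others. -/
def residual (Ω : Matrix (Fin p) (Fin p) ℝ) (i : Fin p) (x : EuclideanSpace ℝ (Fin p)) : ℝ :=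
  (Ω i i)⁻¹ * precisionForm Ω i x

/-- The coefficients of the regression of coordinate `i` on the others. -/
def regressionCoeff (Ω : Matrix (Fin p) (Fin p) ℝ) (i : Fin p) (j : {j : Fin p // j ≠ i}) : ℝ :=
  -(Ω i j / Ω i i)

theorem eq_regression_add_residual {Ω : Matrix (Fin p) (Fin p) ℝ} (hΩ : Ω.PosDef) (i : Fin p)
    (x : EuclideanSpace ℝ (Fin p)) :
    x i = restrictNe i x ⬝ᵥ regressionCoeff Ω i + residual Ω i x := by
  have hii : Ω i i ≠ 0 := (hΩ.diag_pos (i := i)).ne'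
  have h := Fintype.sum_eq_add_sum_subtype_ne (fun k => Ω i k * x k) i
  rw [residual, precisionForm_apply, h, mul_add, Finset.mul_sum, dotProduct]
  have h2 : ∀ j : {j : Fin p // j ≠ i}, restrictNe i x j * regressionCoeff Ω i j =
      - ((Ω i i)⁻¹ * (Ω i j * x j)) := fun j => by
    simp only [restrictNe, regressionCoeff]; ring
  simp_rw [h2, Finset.sum_neg_distrib]
  field_simp
  ring

/-- The variance of the residual. -/
def residualVariance (Ω : Matrix (Fin p) (Fin p) ℝ) (i : Fin p) : NNReal := (Ω i i)⁻¹.toNNReal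

theorem residualVariance_ne_zero {Ω : Matrix (Fin p) (Fin p) ℝ} (hΩ : Ω.PosDef) (i : Fin p) :
    residualVariance Ω i ≠ 0 := by
  have := hΩ.diag_pos (i := i)
  simpa [residualVariance] using this

theorem measurable_restrictNe (i : Fin p) : Measurable (restrictNe i) :=
  measurable_pi_lambda _ fun j => by unfold restrictNe; fun_prop

theorem measurable_residual (Ω : Matrix (Fin p) (Fin p) ℝ) (i : Fin p) :
    Measurable (residual Ω i) := by
  unfold residual; fun_prop

theorem map_restrictNe_residual {Ω : Matrix (Fin p) (Fin p) ℝ} (hΩ : Ω.PosDef) (i : Fin p) :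
    (multivariateGaussian 0 Ω⁻¹).map (fun x => (restrictNe i x, residual Ω i x)) =
      ((multivariateGaussian 0 Ω⁻¹).map (restrictNe i)).prod
        (gaussianReal 0 (residualVariance Ω i)) := by
  have hind : IndepFun (restrictNe i) (residual Ω i) (multivariateGaussian 0 Ω⁻¹) :=
    (indepFun_restrictNe_precisionForm hΩ i).comp (φ := id) (ψ := fun y => (Ω i i)⁻¹ * y)
      measurable_id (by fun_prop)
  rw [(indepFun_iff_map_prod_eq_prod_map_map (measurable_restrictNe i).aemeasurable
    (measurable_residual Ω i).aemeasurable).1 hind]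
  congr 1
  have hlaw : HasGaussianLaw (residual Ω i) (multivariateGaussian 0 Ω⁻¹) :=
    IsGaussian.hasGaussianLaw_id.map_fun ((Ω i i)⁻¹ • precisionForm Ω i)
  rw [hlaw.map_eq_gaussianReal]
  have hii : Ω i i ≠ 0 := (hΩ.diag_pos (i := i)).ne'
  congr 1
  · exact integral_clm_multivariateGaussian _ ((Ω i i)⁻¹ • precisionForm Ω i)
  · unfold residual residualVariance
    rw [variance_const_mul, variance_precisionForm hΩ]
    congr 1
    field_simp

end Regression

/-! ### Conditional independence and the precision matrix -/

section CondExp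

variable {Ω : Type*} {m' mΩ : MeasurableSpace Ω} {μ : Measure Ω} [IsProbabilityMeasure μ]

/-- The conditional expectation of a product of conditionally independent variables. -/
theorem _root_.ProbabilityTheory.CondIndepFun.condExp_mul [StandardBorelSpace Ω] {hm : m' ≤ mΩ}
    {f g : Ω → ℝ} (h : CondIndepFun m' hm f g μ) (hf : Measurable f) (hg : Measurable g)
    (hf2 : MemLp f 2 μ) (hg2 : MemLp g 2 μ) :
    μ[fun x => f x * g x | m'] =ᵐ[μ] fun x => (μ[f | m']) x * (μ[g | m']) x := by
  have h1 := ae_eq_of_ae_eq_trim ((condIndepFun_iff_map_prod_eq_prod_map_map hf hg).1 h)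
  filter_upwards [h1, condExp_ae_eq_integral_condExpKernel hm (hf2.integrable_mul hg2),
    condExp_ae_eq_integral_condExpKernel hm (hf2.integrable one_le_two),
    condExp_ae_eq_integral_condExpKernel hm (hg2.integrable one_le_two)] with x hx hfg hf' hg'
  change (μ[f * g | m']) x = _
  rw [hfg, hf', hg']
  rw [Kernel.map_apply _ (hf.prodMk hg), Kernel.prod_apply, Kernel.map_apply _ hf,
    Kernel.map_apply _ hg] at hx
  have e1 : ∫ y, (f * g) y ∂(condExpKernel μ m' x) =
      ∫ z : ℝ × ℝ, z.1 * z.2 ∂((condExpKernel μ m' x).map fun y => (f y, g y)) := by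
    rw [integral_map (hf.prodMk hg).aemeasurable (by fun_prop)]
    rfl
  rw [e1, hx, integral_prod_mul (fun y => y) (fun y => y), integral_map hf.aemeasurable (by fun_prop),
    integral_map hg.aemeasurable (by fun_prop)]

/-- Pulling the `m'`-measurable factor out: against such a factor a variable may be replaced by its
conditional expectation. -/
theorem integral_mul_of_condExp (hm : m' ≤ mΩ) {f z : Ω → ℝ} (hz : StronglyMeasurable[m'] z)
    (hf2 : MemLp f 2 μ) (hz2 : MemLp z 2 μ) :
    ∫ x, f x * z x ∂μ = ∫ x, (μ[f | m']) x * z x ∂μ := by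
  have h := condExp_mul_of_stronglyMeasurable_right hz (hf2.integrable_mul hz2)
    (hf2.integrable one_le_two)
  rw [← integral_condExp hm]
  exact integral_congr_ae h

/-- The residuals of conditionally independent variables are uncorrelated. -/
theorem integral_residual_mul_residual [StandardBorelSpace Ω] {hm : m' ≤ mΩ}
    {f g : Ω → ℝ} (h : CondIndepFun m' hm f g μ) (hf : Measurable f) (hg : Measurable g)
    (hf2 : MemLp f 2 μ) (hg2 : MemLp g 2 μ) :
    ∫ x, (f x - (μ[f | m']) x) * (g x - (μ[g | m']) x) ∂μ = 0 := by
  have hfm : MemLp (μ[f | m']) 2 μ := hf2.condExp one_le_two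
  have hgm : MemLp (μ[g | m']) 2 μ := hg2.condExp one_le_two
  have h1 : ∫ x, f x * g x ∂μ = ∫ x, (μ[f | m']) x * (μ[g | m']) x ∂μ := by
    rw [← integral_condExp hm]
    exact integral_congr_ae (h.condExp_mul hf hg hf2 hg2)
  have h2 := integral_mul_of_condExp hm stronglyMeasurable_condExp hf2 hgm
  have h3 := integral_mul_of_condExp hm stronglyMeasurable_condExp hg2 hfm
  have e : ∀ x, (f x - (μ[f | m']) x) * (g x - (μ[g | m']) x) = f x * g x - f x * (μ[g | m']) x -
      (g x * (μ[f | m']) x - (μ[g | m']) x * (μ[f | m']) x) := fun x => by ring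
  simp_rw [e]
  rw [integral_sub, integral_sub, integral_sub, h1, h2, h3]
  · ring
  · exact hg2.integrable_mul hfm
  · exact hgm.integrable_mul hfm
  · exact hf2.integrable_mul hg2
  · exact hf2.integrable_mul hgm
  · exact (hf2.integrable_mul hg2).sub (hf2.integrable_mul hgm)
  · exact (hg2.integrable_mul hfm).sub (hgm.integrable_mul hfm)

end CondExp

section Precision

variable {p : ℕ}

theorem integral_mul_precisionForm {Ω : Matrix (Fin p) (Fin p) ℝ} (hΩ : Ω.PosDef) (i j : Fin p) :
    ∫ x, precisionForm Ω i x * x j ∂(multivariateGaussian 0 Ω⁻¹) = if j = i then 1 else 0 := by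
  have h := covariance_eq_sub (memLp_eval_multivariateGaussian Ω⁻¹ j) (memLp_precisionForm Ω Ω⁻¹ i)
  rw [covariance_precisionForm hΩ, integral_clm_multivariateGaussian, mul_zero, sub_zero] at h
  rw [h]
  simp [mul_comm]

theorem otherCoordinates_le_comap (i j : Fin p) :
    otherCoordinates i j ≤ MeasurableSpace.comap (restrictNe i) inferInstance := by
  refine iSup_le fun k => ?_
  rw [← measurable_iff_comap_le]
  exact (measurable_pi_apply (⟨k.1, k.2.1⟩ : {j : Fin p // j ≠ i})).comp
    (comap_measurable (restrictNe i))

theorem condExp_precisionForm {Ω : Matrix (Fin p) (Fin p) ℝ} (hΩ : Ω.PosDef) (i j : Fin p) :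
    (multivariateGaussian 0 Ω⁻¹)[fun x => precisionForm Ω i x | otherCoordinates i j]
      =ᵐ[multivariateGaussian 0 Ω⁻¹] fun _ => 0 := by
  have hind : Indep (MeasurableSpace.comap (fun x => precisionForm Ω i x) inferInstance)
      (otherCoordinates i j) (multivariateGaussian 0 Ω⁻¹) :=
    indep_of_indep_of_le_right (indepFun_restrictNe_precisionForm hΩ i).symm
      (otherCoordinates_le_comap i j)
  have := condExp_indep_eq (Measurable.comap_le (by fun_prop)) (otherCoordinates_le i j)
    (comap_measurable (fun x => precisionForm Ω i x)).stronglyMeasurable hind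
  rwa [integral_clm_multivariateGaussian] at this

/-- Conditionally independent coordinates of a Gaussian vector have a vanishing entry of the
precision matrix. -/
theorem precision_eq_zero_of_condIndep {Ω : Matrix (Fin p) (Fin p) ℝ} (hΩ : Ω.PosDef) {i j : Fin p}
    (hij : i ≠ j) (h : CondIndepGivenRest (multivariateGaussian 0 Ω⁻¹) i j) : Ω i j = 0 := by
  set μ := multivariateGaussian 0 Ω⁻¹ with hμ
  have hFle := otherCoordinates_le i j
  set A : EuclideanSpace ℝ (Fin p) → ℝ := fun x => x i with hA
  set B : EuclideanSpace ℝ (Fin p) → ℝ := fun x => x j with hB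
  have hAm : Measurable A := by fun_prop
  have hBm : Measurable B := by fun_prop
  have hA2 : MemLp A 2 μ := memLp_eval_multivariateGaussian _ i
  have hB2 : MemLp B 2 μ := memLp_eval_multivariateGaussian _ j
  have hAB := integral_residual_mul_residual (μ := μ) (hm := hFle) h hAm hBm hA2 hB2
  have hcA2 : MemLp (μ[A | otherCoordinates i j]) 2 μ := hA2.condExp one_le_two
  have hcB2 : MemLp (μ[B | otherCoordinates i j]) 2 μ := hB2.condExp one_le_two
  -- the part of the form that depends on the other coordinates
  set L : EuclideanSpace ℝ (Fin p) → ℝ := fun x => ∑ k : {k : Fin p // k ≠ i ∧ k ≠ j}, Ω i k * x k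
    with hL
  have hLm : StronglyMeasurable[otherCoordinates i j] L := by
    refine Measurable.stronglyMeasurable ?_
    refine Finset.measurable_sum _ fun k _ => Measurable.const_mul ?_ _
    exact measurable_iff_comap_le.2 (le_iSup (fun k : {k : Fin p // k ≠ i ∧ k ≠ j} =>
      MeasurableSpace.comap (fun x : EuclideanSpace ℝ (Fin p) => x k) inferInstance) k)
  have hL2 : MemLp L 2 μ :=
    memLp_finsetSum _ fun k _ => (memLp_eval_multivariateGaussian _ k.1).const_mul _
  have hdecomp : ∀ x, precisionForm Ω i x = Ω i i * A x + Ω i j * B x + L x := by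
    intro x
    rw [precisionForm_apply, ← Finset.add_sum_erase _ _ (Finset.mem_univ i),
      ← Finset.add_sum_erase _ _ (Finset.mem_erase.2 ⟨hij.symm, Finset.mem_univ j⟩), ← add_assoc]
    congr 1
    refine Finset.sum_subtype _ (fun k => ?_) _
    simp [and_comm]
  -- The form (Ωx)_i has conditional mean zero, and its part `L` is already measurable with respect
  -- to the conditioning σ-algebra.
  have hcond : ∀ᵐ x ∂μ, Ω i i * (μ[A | otherCoordinates i j]) x +
      Ω i j * (μ[B | otherCoordinates i j]) x + L x = 0 := by
    have h0 := condExp_precisionForm hΩ i j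
    have e : (fun x => precisionForm Ω i x) = (Ω i i • A + Ω i j • B) + L := by
      ext x; simp [hdecomp]
    rw [e] at h0
    have iA := hA2.integrable one_le_two
    have iB := hB2.integrable one_le_two
    have iL := hL2.integrable one_le_two
    filter_upwards [h0, condExp_add ((iA.smul (Ω i i)).add (iB.smul (Ω i j))) iL (otherCoordinates i j),
      condExp_add (iA.smul (Ω i i)) (iB.smul (Ω i j)) (otherCoordinates i j),
      condExp_smul (μ := μ) (Ω i i) A (otherCoordinates i j),
      condExp_smul (μ := μ) (Ω i j) B (otherCoordinates i j)] with x h0 h1 h2 h3 h4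
    rw [h1, Pi.add_apply, h2, Pi.add_apply, h3, h4, condExp_of_stronglyMeasurable hFle hLm iL] at h0
    simpa using h0
  set B' : EuclideanSpace ℝ (Fin p) → ℝ := fun x => B x - (μ[B | otherCoordinates i j]) x with hB'
  have hB'2 : MemLp B' 2 μ := hB2.sub hcB2
  -- Subtracting the conditional mean of `B` does not affect the pairing with (Ωx)_k, whose own
  -- conditional mean is zero. The pairing is therefore 0 for k = i and 1 for k = j.
  have key : ∀ k, (∀ᵐ x ∂μ, (μ[fun x => precisionForm Ω k x | otherCoordinates i j]) x = 0) →
      ∫ x, precisionForm Ω k x * B' x ∂μ = if j = k then 1 else 0 := by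
    intro k hk
    have h1 : ∫ x, precisionForm Ω k x * (μ[B | otherCoordinates i j]) x ∂μ = 0 := by
      rw [integral_mul_of_condExp hFle stronglyMeasurable_condExp (memLp_precisionForm _ _ _) hcB2]
      exact integral_eq_zero_of_ae (hk.mono fun x hx => mul_eq_zero_of_left hx _)
    have e : ∀ x, precisionForm Ω k x * B' x =
        precisionForm Ω k x * B x - precisionForm Ω k x * (μ[B | otherCoordinates i j]) x := fun x => by
      simp only [hB']; ring
    simp_rw [e]
    have i1 : Integrable (fun x => precisionForm Ω k x * B x) μ :=
      (memLp_precisionForm Ω Ω⁻¹ k).integrable_mul hB2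
    have i2 : Integrable (fun x => precisionForm Ω k x * (μ[B | otherCoordinates i j]) x) μ :=
      (memLp_precisionForm Ω Ω⁻¹ k).integrable_mul hcB2
    rw [integral_sub i1 i2, h1, sub_zero]
    exact integral_mul_precisionForm hΩ k j
  have hi := key i (condExp_precisionForm hΩ i j)
  have hj := key j (by rw [otherCoordinates_comm]; exact condExp_precisionForm hΩ j i)
  rw [if_neg hij.symm] at hi
  rw [if_pos rfl] at hj
  -- By `hcond` the form (Ωx)_i is Ω_ii times the residual of `A` plus Ω_ij times the residual of
  -- `B`; the product of the two residuals integrates to zero by conditional independence.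
  have hi' : ∫ x, precisionForm Ω i x * B' x ∂μ = Ω i j * ∫ x, B' x ^ 2 ∂μ := by
    have e : ∀ᵐ x ∂μ, precisionForm Ω i x * B' x =
        Ω i i * ((A x - (μ[A | otherCoordinates i j]) x) * (B x - (μ[B | otherCoordinates i j]) x)) + Ω i j * B' x ^ 2 := by
      filter_upwards [hcond] with x hx
      have : precisionForm Ω i x = Ω i i * (A x - (μ[A | otherCoordinates i j]) x) + Ω i j * B' x := by
        rw [hdecomp]; simp only [hB']; linarith
      rw [this]; simp only [hB']; ring
    rw [integral_congr_ae e, integral_add, integral_const_mul, integral_const_mul, hAB, mul_zero,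
      zero_add]
    · exact ((hA2.sub hcA2).integrable_mul hB'2).const_mul _
    · exact hB'2.integrable_sq.const_mul _
  rw [hi'] at hi
  -- The residual of `B` cannot vanish almost surely, because its pairing with (Ωx)_j is 1.
  refine (mul_eq_zero.1 hi).resolve_right fun h0 => ?_
  have hzero : ∀ᵐ x ∂μ, B' x = 0 := by
    have := (integral_eq_zero_iff_of_nonneg (fun x => sq_nonneg _) hB'2.integrable_sq).1 h0
    filter_upwards [this] with x hx
    simpa using hx
  have : ∫ x, precisionForm Ω j x * B' x ∂μ = 0 :=
    integral_eq_zero_of_ae (hzero.mono fun x hx => by simp [hx])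
  linarith

theorem precision_eq_zero_of_mem_nullSet {Ω : Matrix (Fin p) (Fin p) ℝ} (hΩ : Ω.PosDef)
    {i j : Fin p} (h : j ∈ nullSet (condIndepGraph (multivariateGaussian 0 Ω⁻¹)) i) :
    j ≠ i ∧ Ω i j = 0 := by
  classical
  simp only [nullSet, Finset.mem_filter, Finset.mem_univ, true_and, condIndepGraph, not_and,
    not_not] at h
  exact ⟨h.1, precision_eq_zero_of_condIndep hΩ h.1.symm (h.2 h.1.symm)⟩

end Precision

/-! ### Linear independence of Gaussian columns -/

section LinearIndependence

theorem isUnit_det_transpose_mul_self_iff {n ι : Type*} [Fintype n] [Fintype ι] [DecidableEq ι]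
    (A : Matrix n ι ℝ) : IsUnit (Aᵀ * A).det ↔ LinearIndependent ℝ A.col := by
  rw [← Matrix.mulVec_injective_iff, ← Matrix.isUnit_iff_isUnit_det,
    ← Matrix.mulVec_injective_iff_isUnit]
  have h := ker_mulVecLin_transpose_mul_self A
  change Function.Injective (Aᵀ * A).mulVecLin ↔ Function.Injective A.mulVecLin
  rw [← LinearMap.ker_eq_bot, ← LinearMap.ker_eq_bot, h]

theorem measurableSet_linearIndependent {α n ι : Type*} [Fintype n] [Fintype ι] [MeasurableSpace α]
    {v : α → ι → n → ℝ} (hv : Measurable v) : MeasurableSet {x | LinearIndependent ℝ (v x)} := by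
  classical
  have h : {x | LinearIndependent ℝ (v x)} =
      v ⁻¹' ({u | ((Matrix.of u * (Matrix.of u)ᵀ).det) = 0}ᶜ) := by
    ext x
    have := isUnit_det_transpose_mul_self_iff (Matrix.of (v x))ᵀ
    rw [isUnit_iff_ne_zero, transpose_transpose] at this
    exact this.symm
  rw [h]
  refine hv (IsClosed.measurableSet ?_).compl
  refine isClosed_eq (Continuous.matrix_det ?_) continuous_const
  exact continuous_id.matrix_mul continuous_id.matrix_transpose

/-- A proper subspace lies in the kernel of a nonzero linear functional. That functional of the
noise is Gaussian with positive variance, so it misses the single value that membership would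
require. -/
theorem ae_add_notMem {n : Type*} [Fintype n] {v : NNReal} (hv : v ≠ 0)
    {V : Submodule ℝ (n → ℝ)} (hV : V ≠ ⊤) (m : n → ℝ) :
    ∀ᵐ e ∂(Measure.pi fun _ : n => gaussianReal 0 v), m + e ∉ V := by
  classical
  obtain ⟨L, hL, hle⟩ := V.exists_le_ker_of_lt_top (lt_top_iff_ne_top.2 hV)
  obtain ⟨k, hk⟩ : ∃ k, L (Pi.single k 1) ≠ 0 := by
    by_contra! h
    refine hL (LinearMap.pi_ext' fun k => LinearMap.ext_ring ?_)
    simpa using h k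
  have hvar : ∀ e : n → ℝ, L e = ∑ j, L (Pi.single j 1) * e j := by
    intro e
    conv_lhs => rw [← Finset.univ_sum_single e, map_sum]
    refine Finset.sum_congr rfl fun j _ => ?_
    rw [show (Pi.single j (e j) : n → ℝ) = e j • Pi.single j 1 by
      rw [← Pi.single_smul]; simp, map_smul, smul_eq_mul, mul_comm]
  set γ := Measure.pi fun _ : n => gaussianReal 0 v with hγ
  have hLm : Measurable L := L.continuous_of_finiteDimensional.measurable
  have hid : HasGaussianLaw (fun (e : n → ℝ) j => e j) γ := by
    refine iIndepFun.hasGaussianLaw (fun j => ?_)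
      (iIndepFun_pi (X := fun (_ : n) (x : ℝ) => x) fun _ => aemeasurable_id)
    have h : γ.map (fun e => e j) = gaussianReal 0 v :=
      (measurePreserving_eval (fun _ : n => gaussianReal 0 v) j).map_eq
    exact ⟨by rw [h]; infer_instance⟩
  have hgauss : HasGaussianLaw (fun e => L e) γ := hid.map_fun L.toContinuousLinearMap
  have hV2 : Var[fun e => L e; γ] ≠ 0 := by
    have e : (fun e => L e) = ∑ j, fun e : n → ℝ => L (Pi.single j 1) * e j := by
      ext e; rw [hvar]; simp
    rw [e, hγ, variance_sum_pi (X := fun j (x : ℝ) => L (Pi.single j 1) * x)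
      (fun j => IsGaussian.memLp_two_id.const_mul _)]
    have e2 : ∀ j, Var[fun x : ℝ => L (Pi.single j 1) * x; gaussianReal 0 v] =
        L (Pi.single j 1) ^ 2 * v := fun j => by
      rw [variance_const_mul]
      congr 1
      exact variance_id_gaussianReal
    have e3 : ∑ j, Var[fun x : ℝ => L (Pi.single j 1) * x; gaussianReal 0 v] ≠ 0 := by
      simp_rw [e2]
      have hv' : (0 : ℝ) < v := by positivity
      refine (Finset.sum_pos' (fun j _ => by positivity) ⟨k, Finset.mem_univ k, ?_⟩).ne'
      positivity
    exact e3
  have hlaw := hgauss.map_eq_gaussianReal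
  have hne : (Var[fun e => L e; γ]).toNNReal ≠ 0 := by
    have := variance_nonneg (fun e => L e) γ
    rw [Ne, Real.toNNReal_eq_zero, not_le]
    exact lt_of_le_of_ne this hV2.symm
  have hatoms := nullSingletonClass_gaussianReal (μ := γ[fun e => L e]) hne
  rw [← hlaw] at hatoms
  have h0 : γ ((fun e => L e) ⁻¹' {-L m}) = 0 := by
    rw [← Measure.map_apply hLm (measurableSet_singleton _)]
    exact measure_singleton _
  refine measure_mono_null (fun e he => ?_) h0
  have he' : m + e ∈ V := not_not.1 he
  have := hle he'
  rw [LinearMap.mem_ker, map_add] at this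
  simp only [Set.mem_preimage, Set.mem_singleton_iff]
  linarith

end LinearIndependence

/-! ### Law and rank of the Gaussian data matrix -/

section DataMatrix

variable {n p : ℕ} {Ω : Matrix (Fin p) (Fin p) ℝ} {S : Type*} [MeasurableSpace S] {P : Measure S}
  [IsProbabilityMeasure P] {X : Fin n → S → EuclideanSpace ℝ (Fin p)}

/-- The data other than column `i`. -/
def otherColumns (X : Fin n → S → EuclideanSpace ℝ (Fin p)) (i : Fin p) (ω : S) :
    Fin n → {j : Fin p // j ≠ i} → ℝ :=
  fun k => restrictNe i (X k ω)

/-- The residuals of column `i`. -/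
def residualColumn (Ω : Matrix (Fin p) (Fin p) ℝ) (X : Fin n → S → EuclideanSpace ℝ (Fin p))
    (i : Fin p) (ω : S) : Fin n → ℝ :=
  fun k => residual Ω i (X k ω)

/-- The law of the data other than column `i`. -/
def otherColumnsLaw (n : ℕ) (Ω : Matrix (Fin p) (Fin p) ℝ) (i : Fin p) :
    Measure (Fin n → {j : Fin p // j ≠ i} → ℝ) :=
  Measure.pi fun _ => (multivariateGaussian 0 Ω⁻¹).map (restrictNe i)

/-- The law of the residuals of column `i`. -/
def residualLaw (n : ℕ) (Ω : Matrix (Fin p) (Fin p) ℝ) (i : Fin p) : Measure (Fin n → ℝ) :=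
  Measure.pi fun _ => gaussianReal 0 (residualVariance Ω i)

instance (n : ℕ) (Ω : Matrix (Fin p) (Fin p) ℝ) (i : Fin p) :
    IsProbabilityMeasure (residualLaw n Ω i) := by
  unfold residualLaw
  infer_instance

omit [IsProbabilityMeasure P] in
theorem aemeasurable_otherColumns (hX : ∀ k, AEMeasurable (X k) P) (i : Fin p) :
    AEMeasurable (otherColumns X i) P :=
  aemeasurable_pi_lambda _ fun k => (measurable_restrictNe i).comp_aemeasurable (hX k)

omit [IsProbabilityMeasure P] in
theorem aemeasurable_residualColumn (hX : ∀ k, AEMeasurable (X k) P) (i : Fin p) :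
    AEMeasurable (residualColumn Ω X i) P :=
  aemeasurable_pi_lambda _ fun k => (measurable_residual Ω i).comp_aemeasurable (hX k)

/-- Within a row the other coordinates and the residual are independent, and the rows are
independent; regrouping the product over rows separates design from noise. -/
theorem map_otherColumns_residualColumn (hΩ : Ω.PosDef) (hXindep : iIndepFun X P)
    (hXlaw : ∀ k, HasLaw (X k) (multivariateGaussian 0 Ω⁻¹) P) (i : Fin p) :
    P.map (fun ω => (otherColumns X i ω, residualColumn Ω X i ω)) =
      (otherColumnsLaw n Ω i).prod (residualLaw n Ω i) := by
  have hm := (measurable_restrictNe i).prodMk (measurable_residual Ω i)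
  have hX : ∀ k, AEMeasurable (X k) P := fun k => (hXlaw k).aemeasurable
  have h1 := (hXindep.comp (fun _ x => (restrictNe i x, residual Ω i x)) fun _ => hm)
  have h2 := (iIndepFun_iff_map_fun_eq_pi_map fun k => hm.comp_aemeasurable (hX k)).1 h1
  have h3 : ∀ k, P.map ((fun x => (restrictNe i x, residual Ω i x)) ∘ X k) =
      ((multivariateGaussian 0 Ω⁻¹).map (restrictNe i)).prod
        (gaussianReal 0 (residualVariance Ω i)) := fun k => by
    rw [← AEMeasurable.map_map_of_aemeasurable hm.aemeasurable (hX k), (hXlaw k).map_eq,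
      map_restrictNe_residual hΩ]
  simp_rw [h3] at h2
  have := Measure.isProbabilityMeasure_map (μ := multivariateGaussian 0 Ω⁻¹)
    (measurable_restrictNe i).aemeasurable
  have h4 := (measurePreserving_arrowProdEquivProdArrow _ _ (Fin n)
    (fun _ => (multivariateGaussian 0 Ω⁻¹).map (restrictNe i))
    (fun _ => gaussianReal 0 (residualVariance Ω i))).map_eq
  rw [← h2, AEMeasurable.map_map_of_aemeasurable (MeasurableEquiv.measurable _).aemeasurable
    (aemeasurable_pi_lambda _ fun k => hm.comp_aemeasurable (hX k))] at h4
  exact h4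

omit [MeasurableSpace S] in
theorem column_eq (hΩ : Ω.PosDef) (i : Fin p) (ω : S) :
    (fun k => X k ω i) = Matrix.of (otherColumns X i ω) *ᵥ regressionCoeff Ω i +
      residualColumn Ω X i ω := by
  ext k
  exact eq_regression_add_residual hΩ i (X k ω)

/-- The columns of the data matrix are almost surely linearly independent. -/
theorem ae_linearIndependent_columns (hpn : p ≤ n) (hΩ : Ω.PosDef) (hXindep : iIndepFun X P)
    (hXlaw : ∀ k, HasLaw (X k) (multivariateGaussian 0 Ω⁻¹) P) :
    ∀ᵐ ω ∂P, LinearIndependent ℝ fun (j : Fin p) (k : Fin n) => X k ω j := by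
  classical
  have hX : ∀ k, AEMeasurable (X k) P := fun k => (hXlaw k).aemeasurable
  have key : ∀ J : Finset (Fin p), ∀ᵐ ω ∂P,
      LinearIndepOn ℝ (fun (j : Fin p) (k : Fin n) => X k ω j) (J : Set (Fin p)) := by
    intro J
    induction J using Finset.induction_on with
    | empty => exact ae_of_all _ fun ω => by simp
    | insert i J hiJ ih =>
      -- the columns as functions of the other columns and of the residuals
      let col : (Fin n → {j : Fin p // j ≠ i} → ℝ) × (Fin n → ℝ) → Fin p → Fin n → ℝ :=
        fun z j k => if h : j ≠ i then z.1 k ⟨j, h⟩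
          else (Matrix.of z.1 *ᵥ regressionCoeff Ω i + z.2) k
      have hcolm : Measurable col := by
        refine measurable_pi_lambda _ fun j => measurable_pi_lambda _ fun k => ?_
        by_cases h : j ≠ i
        · simp only [col, dif_pos h]; fun_prop
        · simp only [col, dif_neg h, Pi.add_apply, mulVec, dotProduct, Matrix.of_apply]; fun_prop
      have hcol : ∀ ω, col (otherColumns X i ω, residualColumn Ω X i ω) =
          fun (j : Fin p) (k : Fin n) => X k ω j := by
        intro ω
        ext j k
        by_cases h : j ≠ i
        · simp only [col, dif_pos h]; rfl
        · simp only [col, dif_neg h]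
          rw [← column_eq hΩ i ω, not_not.1 h]
      have hset : ∀ I : Finset (Fin p),
          MeasurableSet {z | LinearIndepOn ℝ (col z) (I : Set (Fin p))} := fun I =>
        measurableSet_linearIndependent (v := fun z (j : (I : Set (Fin p))) => col z j)
          (measurable_pi_lambda _ fun j => (measurable_pi_apply _).comp hcolm)
      have hprod : ∀ᵐ z ∂((otherColumnsLaw n Ω i).prod (residualLaw n Ω i)),
          LinearIndepOn ℝ (col z) (J : Set (Fin p)) →
            LinearIndepOn ℝ (col z) ((insert i J : Finset (Fin p)) : Set (Fin p)) := by
        have hs : MeasurableSet {z | LinearIndepOn ℝ (col z) (J : Set (Fin p)) →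
            LinearIndepOn ℝ (col z) ((insert i J : Finset (Fin p)) : Set (Fin p))} := by
          have := (hset J).compl.union (hset (insert i J))
          convert this using 1
          ext z
          simp only [Set.mem_ofPred_eq, Set.mem_union, Set.mem_compl_iff]
          tauto
        rw [Measure.ae_prod_iff_ae_ae hs]
        refine ae_of_all _ fun D => ?_
        have hcolJ : ∀ e, col (D, e) '' (J : Set (Fin p)) = col (D, 0) '' (J : Set (Fin p)) := by
          intro e
          refine Set.image_congr fun j hj => ?_
          have h : j ≠ i := fun h => hiJ (h ▸ hj)
          ext k
          simp only [col, dif_pos h]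
        -- Since i ∉ J, |J| < p ≤ n, so the columns indexed by J, which do not involve the noise,
        -- span a proper subspace.
        have hspan : Submodule.span ℝ (col (D, 0) '' (J : Set (Fin p))) ≠ ⊤ := by
          intro htop
          have h1 := finrank_span_finset_le_card (R := ℝ) (J.image (col (D, 0)))
          rw [Set.finrank, Finset.coe_image, htop, finrank_top, Module.finrank_fintype_fun_eq_card,
            Fintype.card_fin] at h1
          have h2 := (h1.trans Finset.card_image_le).trans_lt (Finset.card_lt_univ_of_notMem hiJ)
          rw [Fintype.card_fin] at h2
          omega
        filter_upwards [ae_add_notMem (residualVariance_ne_zero hΩ i) hspan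
          (Matrix.of D *ᵥ regressionCoeff Ω i)] with e he hJ
        rw [Finset.coe_insert, linearIndepOn_insert (by simpa using hiJ)]
        refine ⟨hJ, ?_⟩
        rw [hcolJ]
        convert he using 2
        ext k
        simp [col]
      rw [← map_otherColumns_residualColumn hΩ hXindep hXlaw i] at hprod
      have := ae_of_ae_map ((aemeasurable_otherColumns hX i).prodMk
        (aemeasurable_residualColumn hX i)) hprod
      filter_upwards [this, ih] with ω h1 h2
      rw [hcol] at h1
      exact h1 h2
  filter_upwards [key Finset.univ] with ω hω
  rwa [Finset.coe_univ, linearIndepOn_univ_iff] at hω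

end DataMatrix

/-! ### Rescaled designs -/

section Rescaling

variable {n ι : Type*} [Fintype n] [Fintype ι] [DecidableEq ι]

omit [Fintype ι] [DecidableEq ι] in
theorem sqrt_sum_sq_ne_zero {D : Matrix n ι ℝ} (hD : LinearIndependent ℝ D.col) (j : ι) :
    √(∑ l, D l j ^ 2) ≠ 0 := by
  have h := hD.ne_zero j
  obtain ⟨k, hk⟩ : ∃ k, D k j ≠ 0 := Function.ne_iff.1 h
  exact (Real.sqrt_pos.2 (Finset.sum_pos' (fun l _ => sq_nonneg _)
    ⟨k, Finset.mem_univ k, by positivity⟩)).ne'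

theorem Scaling.isUnit_det_gram (σ : Scaling) {D : Matrix n ι ℝ}
    (hD : LinearIndependent ℝ D.col) : IsUnit ((σ.apply D)ᵀ * σ.apply D).det := by
  rw [isUnit_det_transpose_mul_self_iff]
  cases σ with
  | asGiven => exact hD
  | unitColumns =>
    have h := hD.units_smul fun j => (Units.mk0 _ (sqrt_sum_sq_ne_zero hD j))⁻¹
    convert h using 1
    ext j k
    exact div_eq_inv_mul _ _

-- Rescaling columns rescales coefficients inversely, so null coefficients remain null and the mean
-- response is unchanged.
omit [DecidableEq ι] in
theorem Scaling.exists_mulVec_eq (σ : Scaling) {D : Matrix n ι ℝ}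
    (hD : LinearIndependent ℝ D.col) (β : ι → ℝ) :
    ∃ β' : ι → ℝ, (∀ j, β j = 0 → β' j = 0) ∧ D *ᵥ β = σ.apply D *ᵥ β' := by
  cases σ with
  | asGiven => exact ⟨β, fun _ => id, rfl⟩
  | unitColumns =>
    refine ⟨fun j => √(∑ l, D l j ^ 2) * β j, fun j hj => by simp [hj], ?_⟩
    ext k
    refine Finset.sum_congr rfl fun j _ => ?_
    have := sqrt_sum_sq_ne_zero hD j
    simp only [Scaling.apply, Matrix.of_apply]
    field_simp

omit [Fintype ι] [DecidableEq ι] in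
theorem Scaling.measurable_apply (σ : Scaling) :
    Measurable fun D : n → ι → ℝ => (fun k j => σ.apply (Matrix.of D) k j : n → ι → ℝ) := by
  cases σ with
  | asGiven => exact measurable_id
  | unitColumns =>
    refine measurable_pi_lambda _ fun k => measurable_pi_lambda _ fun j => ?_
    simp only [Scaling.apply, Matrix.of_apply]
    fun_prop

/-- The statistics of a node are a measurable function of the design and of the noise, as long as
the columns of the design are linearly independent. -/
theorem exists_measurable_statistics {O : Strategy} {K : Matrix n ι ℝ → Matrix n ι ℝ}
    (hK : IsKnockoffConstruction O K) {Pr : FeatureProcedure n ι} (hsuff : Pr.Sufficient)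
    (σ : Scaling) (β : ι → ℝ) :
    ∃ F : (n → ι → ℝ) × (n → ℝ) → ι → ℝ, Measurable F ∧
      ∀ D e, LinearIndependent ℝ (Matrix.of D).col →
        Pr (σ.apply (Matrix.of D)) (K (σ.apply (Matrix.of D))) (Matrix.of D *ᵥ β + e) =
          F (D, e) := by
  obtain ⟨f, hf, hW⟩ := hsuff
  refine ⟨fun z => f (fun x y => pairGram (σ.apply (Matrix.of z.1)) (K (σ.apply (Matrix.of z.1)))
      x y,
    (fromCols (σ.apply (Matrix.of z.1)) (K (σ.apply (Matrix.of z.1))))ᵀ *ᵥ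
      (Matrix.of z.1 *ᵥ β + z.2)), ?_,
    fun D e hD => hW _ _ _ (hK.isKnockoff (σ.isUnit_det_gram hD))⟩
  have h1 : ∀ k j, Measurable fun z : (n → ι → ℝ) × (n → ℝ) => σ.apply (Matrix.of z.1) k j :=
    fun k j => (measurable_pi_apply j).comp
      ((measurable_pi_apply k).comp (σ.measurable_apply.comp measurable_fst))
  have h2 : ∀ k j, Measurable fun z : (n → ι → ℝ) × (n → ℝ) => K (σ.apply (Matrix.of z.1)) k j :=
    fun k j => (measurable_pi_apply j).comp
      ((measurable_pi_apply k).comp (hK.1.comp (σ.measurable_apply.comp measurable_fst)))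
  have h3 : ∀ k x, Measurable fun z : (n → ι → ℝ) × (n → ℝ) =>
      fromCols (σ.apply (Matrix.of z.1)) (K (σ.apply (Matrix.of z.1))) k x := by
    rintro k (j | j)
    · exact h1 k j
    · exact h2 k j
  refine hf.comp (Measurable.prodMk ?_ ?_)
  · refine measurable_pi_lambda _ fun x => measurable_pi_lambda _ fun y => ?_
    simp only [pairGram, Matrix.mul_apply, transpose_apply]
    exact Finset.measurable_sum _ fun k _ => (h3 k x).mul (h3 k y)
  · refine measurable_pi_lambda _ fun x => ?_
    simp only [mulVec, dotProduct, transpose_apply, Pi.add_apply, Matrix.of_apply]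
    exact Finset.measurable_sum _ fun k _ => (h3 k x).mul (by fun_prop)

end Rescaling

/-! ### The feature statistics of the graphical model -/

section NodeStatistics

open scoped ENNReal

variable {n p : ℕ} {Ω : Matrix (Fin p) (Fin p) ℝ} {S : Type*} [MeasurableSpace S] {P : Measure S}
  [IsProbabilityMeasure P] {X : Fin n → S → EuclideanSpace ℝ (Fin p)}

/-- Extension by zero to coordinate `i`. -/
def extendZero (i : Fin p) (u : {j : Fin p // j ≠ i} → ℝ) (j : Fin p) : ℝ :=
  if h : j ≠ i then u ⟨j, h⟩ else 0

theorem measurable_extendZero (i : Fin p) : Measurable (extendZero i) := by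
  refine measurable_pi_lambda _ fun j => ?_
  by_cases h : j ≠ i
  · simp only [extendZero, dif_pos h]; fun_prop
  · simp only [extendZero, dif_neg h]; fun_prop

theorem flipSigns_extendZero (H : Finset (Fin p)) (i : Fin p) (u : {j : Fin p // j ≠ i} → ℝ) :
    flipSigns H (extendZero i u) = extendZero i fun j => if j.1 ∈ H then - u j else u j := by
  ext j
  by_cases h : j ≠ i <;> by_cases hj : j ∈ H <;> simp [flipSigns, extendZero, h, hj]

omit [MeasurableSpace S] in
theorem featureStatistics_eq (hΩ : Ω.PosDef) (σ : Scaling)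
    (K : ∀ i : Fin p, Matrix (Fin n) {j : Fin p // j ≠ i} ℝ →
      Matrix (Fin n) {j : Fin p // j ≠ i} ℝ)
    (Pr : ∀ i : Fin p, FeatureProcedure (Fin n) {j : Fin p // j ≠ i}) (i : Fin p) (ω : S) :
    featureStatistics σ K Pr (Matrix.of fun k j => X k ω j) i =
      extendZero i (Pr i (σ.apply (Matrix.of (otherColumns X i ω)))
        (K i (σ.apply (Matrix.of (otherColumns X i ω))))
        (Matrix.of (otherColumns X i ω) *ᵥ regressionCoeff Ω i + residualColumn Ω X i ω)) := by
  rw [← column_eq hΩ i ω]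
  rfl

theorem ae_linearIndependent_otherColumns (hpn : p ≤ n) (hΩ : Ω.PosDef)
    (hXindep : iIndepFun X P) (hXlaw : ∀ k, HasLaw (X k) (multivariateGaussian 0 Ω⁻¹) P)
    (i : Fin p) : ∀ᵐ ω ∂P, LinearIndependent ℝ (Matrix.of (otherColumns X i ω)).col := by
  filter_upwards [ae_linearIndependent_columns hpn hΩ hXindep hXlaw] with ω hω
  exact hω.comp (Subtype.val : {j : Fin p // j ≠ i} → Fin p) Subtype.val_injective

theorem ae_linearIndependent_otherColumnsLaw (hpn : p ≤ n) (hΩ : Ω.PosDef)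
    (hXindep : iIndepFun X P) (hXlaw : ∀ k, HasLaw (X k) (multivariateGaussian 0 Ω⁻¹) P)
    (i : Fin p) : ∀ᵐ D ∂(otherColumnsLaw n Ω i), LinearIndependent ℝ (Matrix.of D).col := by
  have hX : ∀ k, AEMeasurable (X k) P := fun k => (hXlaw k).aemeasurable
  have h1 := map_otherColumns_residualColumn hΩ hXindep hXlaw i
  have h2 := congrArg Measure.fst h1
  rw [Measure.fst_map_prodMk₀ (aemeasurable_residualColumn hX i), Measure.fst_prod] at h2
  rw [← h2, ae_map_iff (aemeasurable_otherColumns hX i)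
    (measurableSet_linearIndependent (v := fun D : Fin n → {j : Fin p // j ≠ i} → ℝ =>
      (Matrix.of D).col) ?_)]
  · exact ae_linearIndependent_otherColumns hpn hΩ hXindep hXlaw i
  · refine measurable_pi_lambda _ fun j => measurable_pi_lambda _ fun k => ?_
    simp only [Matrix.col_apply, Matrix.of_apply]
    fun_prop

variable {O : Strategy} {σ : Scaling}
  {K : ∀ i : Fin p, Matrix (Fin n) {j : Fin p // j ≠ i} ℝ → Matrix (Fin n) {j : Fin p // j ≠ i} ℝ}
  {Pr : ∀ i : Fin p, FeatureProcedure (Fin n) {j : Fin p // j ≠ i}}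

theorem aemeasurable_featureStatistics (hpn : p ≤ n) (hΩ : Ω.PosDef) (hXindep : iIndepFun X P)
    (hXlaw : ∀ k, HasLaw (X k) (multivariateGaussian 0 Ω⁻¹) P)
    (hK : ∀ i, IsKnockoffConstruction O (K i)) (hsuff : ∀ i, (Pr i).Sufficient) :
    AEMeasurable (fun ω => featureStatistics σ K Pr (Matrix.of fun k j => X k ω j)) P := by
  refine aemeasurable_pi_lambda _ fun i => ?_
  have hX : ∀ k, AEMeasurable (X k) P := fun k => (hXlaw k).aemeasurable
  obtain ⟨F, hF, hFeq⟩ := exists_measurable_statistics (hK i) (hsuff i) σ (regressionCoeff Ω i)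
  have h := ((measurable_extendZero i).comp hF).comp_aemeasurable
    ((aemeasurable_otherColumns hX i).prodMk (aemeasurable_residualColumn (Ω := Ω) hX i))
  refine h.congr ?_
  filter_upwards [ae_linearIndependent_otherColumns hpn hΩ hXindep hXlaw i] with ω hω
  rw [featureStatistics_eq hΩ, hFeq _ _ hω]
  rfl

/-- Fubini over design and noise. The measurable `F` replaces the procedure for the purpose, because
sufficiency controls the procedure only where the Gram matrix is invertible; the designs left out
form a null set. -/
theorem lintegral_featureStatistics (hpn : p ≤ n) (hΩ : Ω.PosDef) (hXindep : iIndepFun X P)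
    (hXlaw : ∀ k, HasLaw (X k) (multivariateGaussian 0 Ω⁻¹) P)
    (hK : ∀ i, IsKnockoffConstruction O (K i)) (hsuff : ∀ i, (Pr i).Sufficient) (i : Fin p)
    {φ : (Fin p → ℝ) → ℝ≥0∞} (hφ : Measurable φ) :
    ∫⁻ ω, φ (featureStatistics σ K Pr (Matrix.of fun k j => X k ω j) i) ∂P =
      ∫⁻ D, ∫⁻ e, φ (extendZero i (Pr i (σ.apply (Matrix.of D)) (K i (σ.apply (Matrix.of D)))
        (Matrix.of D *ᵥ regressionCoeff Ω i + e))) ∂(residualLaw n Ω i) ∂(otherColumnsLaw n Ω i) := by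
  have hX : ∀ k, AEMeasurable (X k) P := fun k => (hXlaw k).aemeasurable
  obtain ⟨F, hF, hFeq⟩ := exists_measurable_statistics (hK i) (hsuff i) σ (regressionCoeff Ω i)
  have hg : Measurable fun z => φ (extendZero i (F z)) := hφ.comp ((measurable_extendZero i).comp hF)
  calc ∫⁻ ω, φ (featureStatistics σ K Pr (Matrix.of fun k j => X k ω j) i) ∂P
      = ∫⁻ ω, φ (extendZero i (F (otherColumns X i ω, residualColumn Ω X i ω))) ∂P := by
        refine lintegral_congr_ae ?_
        filter_upwards [ae_linearIndependent_otherColumns hpn hΩ hXindep hXlaw i] with ω hω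
        rw [featureStatistics_eq hΩ, hFeq _ _ hω]
    _ = ∫⁻ z, φ (extendZero i (F z)) ∂((otherColumnsLaw n Ω i).prod (residualLaw n Ω i)) := by
        rw [← map_otherColumns_residualColumn hΩ hXindep hXlaw i, lintegral_map' hg.aemeasurable
          ((aemeasurable_otherColumns hX i).prodMk (aemeasurable_residualColumn hX i))]
    _ = ∫⁻ D, ∫⁻ e, φ (extendZero i (F (D, e))) ∂(residualLaw n Ω i) ∂(otherColumnsLaw n Ω i) :=
        lintegral_prod _ hg.aemeasurable
    _ = _ := by
        refine lintegral_congr_ae ?_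
        filter_upwards [ae_linearIndependent_otherColumnsLaw hpn hΩ hXindep hXlaw i] with D hD
        simp_rw [hFeq _ _ hD]

/-- For almost every value of the design, the fixed-design symmetry applies to the inner integral
over the noise. -/
theorem signSymmetric_featureStatistics (hpn : p ≤ n) (hΩ : Ω.PosDef) (hXindep : iIndepFun X P)
    (hXlaw : ∀ k, HasLaw (X k) (multivariateGaussian 0 Ω⁻¹) P)
    (hK : ∀ i, IsKnockoffConstruction O (K i)) (hsuff : ∀ i, (Pr i).Sufficient)
    (hanti : ∀ i, (Pr i).Antisymmetric) (i : Fin p) :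
    SignSymmetric P (nullSet (condIndepGraph (multivariateGaussian 0 Ω⁻¹)) i)
      fun ω => featureStatistics σ K Pr (Matrix.of fun k j => X k ω j) i := by
  classical
  intro H hH φ hφ
  rw [lintegral_featureStatistics hpn hΩ hXindep hXlaw hK hsuff i hφ]
  refine Eq.trans ?_ (lintegral_featureStatistics hpn hΩ hXindep hXlaw hK hsuff i
      (hφ.comp (measurable_flipSigns H))).symm
  refine lintegral_congr_ae ?_
  filter_upwards [ae_linearIndependent_otherColumnsLaw hpn hΩ hXindep hXlaw i] with D hD
  obtain ⟨β, hβ, hDβ⟩ := σ.exists_mulVec_eq hD (regressionCoeff Ω i)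
  have hβH : ∀ j ∈ {j : {j : Fin p // j ≠ i} | j.1 ∈ H}, β j = 0 := fun j hj => by
    refine hβ j ?_
    rw [regressionCoeff, (precision_eq_zero_of_mem_nullSet hΩ (hH hj)).2, zero_div, neg_zero]
  have h := lintegral_flip_statistics (hsuff i) (hanti i)
    ((hK i).isKnockoff (σ.isUnit_det_gram hD)) hβH (residualVariance Ω i)
    (hφ.comp (measurable_extendZero i))
  simp_rw [hDβ, Function.comp_apply, flipSigns_extendZero]
  rw [residualLaw]
  convert h using 4
  · rfl
  · exact congrArg (fun u => φ (extendZero i u)) (funext fun j => by congr)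

end NodeStatistics

end GGMKnockoff

end

theorem theorem1 {n p : ℕ} (hnp : 2 * p ≤ n)
    (Ω : Matrix (Fin p) (Fin p) ℝ) (hΩ : Ω.PosDef)
    {S : Type*} [MeasurableSpace S] (P : Measure S) [IsProbabilityMeasure P]
    (X : Fin n → S → EuclideanSpace ℝ (Fin p))
    (hXindep : iIndepFun X P)
    (hXlaw : ∀ k, HasLaw (X k) (multivariateGaussian 0 Ω⁻¹) P)
    (q : ℝ) (hq : q ∈ Set.Icc (0 : ℝ) 1)
    (a c : ℝ) (hac : (a, c) ∈ ({(1, 1.93), (0.01, 102)} : Set (ℝ × ℝ)))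
    (σ : Scaling) (O : Strategy)
    (K : ∀ i : Fin p, Matrix (Fin n) {j : Fin p // j ≠ i} ℝ →
      Matrix (Fin n) {j : Fin p // j ≠ i} ℝ)
    (hK : ∀ i, IsKnockoffConstruction O (K i))
    (Pr : ∀ i : Fin p, FeatureProcedure (Fin n) {j : Fin p // j ≠ i})
    (hsuff : ∀ i, (Pr i).Sufficient) (hanti : ∀ i, (Pr i).Antisymmetric)
    (R : EdgeRule)
    (W : S → Fin p → Fin p → ℝ)
    (hW : W = fun ω => featureStatistics σ K Pr (Matrix.of fun k j => X k ω j))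
    (G : SimpleGraph (Fin p)) (hG : G = condIndepGraph (multivariateGaussian 0 Ω⁻¹)) :
    (Integrable (fun ω => fdp G (estimatedGraph R (W ω) (thresholdAlgorithm R q a c (W ω)))) P ∧
      ∫ ω, fdp G (estimatedGraph R (W ω) (thresholdAlgorithm R q a c (W ω))) ∂P ≤ q) ∧
    ∀ T : S → Fin p → EReal, AEMeasurable T P →
      (∀ᵐ ω ∂P, IsGlobalSolution R q a c (W ω) (T ω)) →
      Integrable (fun ω => fdp G (estimatedGraph R (W ω) (T ω))) P ∧
        ∫ ω, fdp G (estimatedGraph R (W ω) (T ω)) ∂P ≤ q := by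
  subst hW hG
  have hpn : p ≤ n := by omega
  have hWm := aemeasurable_featureStatistics (σ := σ) hpn hΩ hXindep hXlaw hK hsuff
  have hsym := signSymmetric_featureStatistics (σ := σ) hpn hΩ hXindep hXlaw hK hsuff hanti
  -- Both threshold rules enter only through being feasible or identically ⊤; maximality of the
  -- global solution plays no role.
  refine ⟨integral_fdp_le hq.1 hac R _ hWm hsym
    ((measurable_thresholdAlgorithm R q a c).comp_aemeasurable hWm)
    (ae_of_all _ fun ω => thresholdAlgorithm_feasible_or R q a c _), fun T hTm hT =>
    integral_fdp_le hq.1 hac R _ hWm hsym hTm (hT.mono fun ω hω => hω.imp And.left And.right)⟩
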